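/- Let $\mathfrak s$ be $\mathfrak{sl}(2,\mathbb R)$ or $\mathfrak{so}(3)$, let $\mathfrak r$ be a finite-dimensional solvable real Lie algebra, and let $R$ be an irreducible representation of $\mathfrak s$ on $\mathfrak r$ by derivations. Let $\mathfrak g=\mathfrak s\,\overrightarrow{\oplus}_R\,\mathfrak r$ be the semidirect sum, in which $[x,y]=R(x)y$ for $x\in\mathfrak s$, $y\in\mathfrak r$. If $X_1,\dots,X_n$ is a basis of $\mathfrak g$ with $[X_i,X_j]=\sum_k C_{ij}^kX_k$, and $x_1,\dots,x_n$ are the corresponding linear coordinates on $\mathfrak g^*$, an invariant of $\mathfrak g$ is a smooth solution $F$, defined on a dense open subset of $\mathfrak g^*$, of the system $$-\sum_{j,k}C_{ij}^k\,x_k\,\frac{\partial F}{\partial x_j}=0,\qquad 1\le i\le n.$$ Invariants are functionally independent on an open set if their differentials are linearly independent at all points of a dense subset of it. Let $\mathcal N(\mathfrak g)$ be the maximal number of functionally independent invariants. A system of functionally independent invariants on a common dense open set is called a fundamental set of invariants if it has the maximal possible number of elements (also among functionally independent smooth solutions defined only on some nonempty open subset of $\mathfrak g^*$). Then: 1. $\mathfrak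 g$ has non-trivial invariants, that is, $\mathcal N(\mathfrak g)>0$. 2. If $\dim\mathfrak r>\dim\mathfrak s$, then there exists a fundamental set of invariants of $\mathfrak g$ formed by functions that depend only on the variables $x_i$ associated to the elements of a basis of $\mathfrak r$ (in coordinates coming from a basis of $\mathfrak s$ together with a basis of $\mathfrak r$). If moreover $\mathfrak s=\mathfrak{sl}(2,\mathbb R)$ and $\dim\mathfrak r$ is odd, then this fundamental set has $2m-6$ elements, where $2m=\dim\mathfrak g$. -/

import Mathlib

open scoped ContDiff

namespace LieInvariants

section Coordinates

variable {g : Type*} [LieRing g] [LieAlgebra ℝ g] {ι : Type*} [Fintype ι] [DecidableEq ι]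

/-- The structure constants `C_{ij}^k` of a real Lie algebra in a basis `X_i`:
`⁅X_i, X_j⁆ = ∑ k, C_{ij}^k X_k`. -/
noncomputable def structureConstant (b : Module.Basis ι ℝ g) (i j k : ι) : ℝ :=
  b.repr ⁅b i, b j⁆ k

/-- The value at `x` of the partial derivative `∂F/∂x_j`, for a function of the coordinates
`(x_i)` of the dual space `g*`. -/
noncomputable def partialDeriv (F : (ι → ℝ) → ℝ) (j : ι) (x : ι → ℝ) : ℝ :=
  fderiv ℝ F x (Pi.single j 1)

/-- The first order differential operator `X̂_i = - C_{ij}^k x_k ∂/∂x_j` on functions on `g*`. -/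
noncomputable def coadjointField (b : Module.Basis ι ℝ g) (i : ι) (F : (ι → ℝ) → ℝ)
    (x : ι → ℝ) : ℝ :=
  ∑ j, ∑ k, -(structureConstant b i j k * x k * partialDeriv F j x)

/-- `F` is an invariant of `g` on the (open) set `U` of `g*`: a smooth solution on `U` of the system
`X̂_i F = 0`, for all `i`. -/
structure IsInvariantOn (b : Module.Basis ι ℝ g) (U : Set (ι → ℝ)) (F : (ι → ℝ) → ℝ) : Prop where
  smooth : ContDiffOn ℝ ∞ F U
  annihilated : ∀ i, ∀ x ∈ U, coadjointField b i F x = 0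

/-- Functional independence of finitely many functions on the open set `U`: their differentials
are linearly independent at the points of a dense subset of `U`. -/
def FunctionallyIndependentOn {k : ℕ} (U : Set (ι → ℝ)) (F : Fin k → (ι → ℝ) → ℝ) : Prop :=
  U ⊆ closure {x | x ∈ U ∧ LinearIndependent ℝ (fun a => fderiv ℝ (F a) x)}

/-- `F_1, …, F_k` are functionally independent invariants of `g` on `U`. -/
structure IsIndependentFamilyOn (b : Module.Basis ι ℝ g) (U : Set (ι → ℝ)) {k : ℕ}
    (F : Fin k → (ι → ℝ) → ℝ) : Prop where
  invariant : ∀ a, IsInvariantOn b U (F a)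
  independent : FunctionallyIndependentOn U F

/-- The number `𝒩(g)`: the maximal number of functionally independent invariants of `g`.
Invariants need not be polynomial, so they are only required to be defined on a dense open
subset of `g*`. -/
noncomputable def numInvariants (b : Module.Basis ι ℝ g) : ℕ∞ :=
  ⨆ k ∈ {k : ℕ | ∃ U : Set (ι → ℝ), IsOpen U ∧ Dense U ∧
    ∃ F : Fin k → (ι → ℝ) → ℝ, IsIndependentFamilyOn b U F}, (k : ℕ∞)

/-- `F_1, …, F_k` is a fundamental set of invariants of `g`, defined on the dense open set `U`:
a maximal system of functionally independent solutions. There are never more than `k`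
functionally independent invariants, not even if invariants defined only on some nonempty open
set `V` are admitted. -/
structure IsFundamentalSet (b : Module.Basis ι ℝ g) (U : Set (ι → ℝ)) {k : ℕ}
    (F : Fin k → (ι → ℝ) → ℝ) : Prop where
  isOpen : IsOpen U
  dense : Dense U
  family : IsIndependentFamilyOn b U F
  maximal : ∀ (V : Set (ι → ℝ)), IsOpen V → V.Nonempty → ∀ (l : ℕ) (G : Fin l → (ι → ℝ) → ℝ),
    IsIndependentFamilyOn b V G → l ≤ k

end Coordinates

/-- On `U`, the function `F` depends only on the variables `x_i` with `i ∈ S`. -/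
def DependsOnlyOn {ι : Type*} (S : Set ι) (U : Set (ι → ℝ)) (F : (ι → ℝ) → ℝ) : Prop :=
  ∀ x ∈ U, ∀ y ∈ U, (∀ i ∈ S, x i = y i) → F x = F y

section SemidirectSum

variable {s r : Type*} [LieRing s] [LieAlgebra ℝ s] [LieRing r] [LieAlgebra ℝ r]

/-- The representation `R` of `s` on (the vector space) `r`, by derivations of the Lie algebra `r`,
is irreducible: `r ≠ 0` and the only invariant subspaces are `0` and `r`. -/
def IsIrreducibleRep (R : s →ₗ⁅ℝ⁆ LieDerivation ℝ r r) : Prop :=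
  Nontrivial r ∧ ∀ W : Submodule ℝ r, (∀ x : s, ∀ w ∈ W, R x w ∈ W) → W = ⊥ ∨ W = ⊤

/-- The basis of the semidirect sum of `s` and `r` made of a basis of `r` and a basis of `s`.
The variables associated to elements of `r` are those with index `Sum.inl i`. -/
noncomputable def sumBasis (R : s →ₗ⁅ℝ⁆ LieDerivation ℝ r r) {ιr ιs : Type*}
    (br : Module.Basis ιr ℝ r) (bs : Module.Basis ιs ℝ s) :
    Module.Basis (ιr ⊕ ιs) ℝ (LieAlgebra.SemiDirectSum r s R) :=
  (br.prod bs).map (LieAlgebra.SemiDirectSum.toProdl R).symm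

end SemidirectSum

end LieInvariants

/-!
The derived algebra of `r` is stable under derivations, so irreducibility and solvability make `r`
abelian (`IsIrreducibleRep.lie_eq_zero`). The invariants of a Lie algebra are the functions that are
constant along the coadjoint vector fields, which are linear vector fields on the dual space. For a
linear Lie algebra `L` acting on `W`, a point `w` where `dim L w` is locally maximal, equal to `d`,
has a neighbourhood with `dim W - d` independent smooth invariants
(`exists_isInvariantSubmersionAt`): the map `(t, c) ↦ exp (t₁ A₁) ⋯ exp (t_d A_d) (w + c)`, with `c`
in a complement of `L w`, is a local diffeomorphism at `0`, and the components of `c` are the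
invariants. No global integration is needed, because local solutions can be glued on a dense open
set, a union of disjoint open sets on each of which one of them is taken (`exists_dense_of_local`).

For the existence of a non-trivial invariant it is therefore enough that every functional `z` on the
semidirect sum has a degenerate form `z ⁅X, Y⁆` (`exists_lie_eq_zero`). As `r` is abelian, an element
of `r` in the radical exists as soon as `y ↦ (x ↦ z (R x y))`, from `r` to the dual of `s`, is not
injective. If it is injective, `dim r ≤ 3`. In dimension 1 the representation is trivial, in
dimension 2 the semidirect sum has odd dimension, and in dimension 3 the map is bijective, which a
trace identity excludes (`not_bijective_of_perfect`).

If `dim r > 3`, the action of `s` on the dual of `r` has generically zero stabilizers, so that it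
has `dim r - 3` local invariants; composed with the restriction of functionals to `r` these are
invariants of the semidirect sum. There are no more of them: at a functional whose restriction to
`r` has zero stabilizer, the differentials of the invariants lie in the annihilator in `r` of a
space of dimension 3 (`card_le_of_linearIndependent_of_annihilated`). That stabilizers are
generically zero is seen as follows (`exists_isFreeAt`). If `x` stabilizes a point `w` where the
dimension of the orbits is locally maximal, the image of `x` lies in the tangent space of the orbit
of `w` (`apply_mem_orbitTangent_of_isLocalMax`). So if all stabilizers over an open set are nonzero,
then some `x ≠ 0` acts on `r` with rank at most 2. This is impossible on an irreducible
representation of dimension at least 4 (`lt_finrank_range`): a semisimple `x` is, over `ℂ`, a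
multiple of the element `h` of an `sl₂`-triple, and counting dimensions of weight spaces gives a
primitive vector of weight 0, which is invariant under `s`; a nilpotent `x` is the element `e` of a
real triple, and the kernel of `e` then generates a representation of dimension at most 2.
-/

open scoped ContDiff

namespace LieInvariants

open Filter Topology
open scoped RightActions TensorProduct

/-! ### Local invariants of a linear Lie algebra -/

section LinearFrobenius

variable {W : Type*} [NormedAddCommGroup W] [NormedSpace ℝ W]

/-- Conjugation by `exp A` preserves a closed subspace that is stable under `⁅A, ·⁆`: it is the
exponential of the commutator with `A`. -/
theorem exists_exp_mul_eq_mul_exp {E : Type*} [NormedRing E] [NormedAlgebra ℝ E] [CompleteSpace E]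
    {L : Submodule ℝ E} (hL : IsClosed (L : Set E)) {A : E}
    (hA : ∀ B ∈ L, A * B - B * A ∈ L) {B : E} (hB : B ∈ L) :
    ∃ B' ∈ L, NormedSpace.exp A * B = B' * NormedSpace.exp A := by
  let _ : NormedAlgebra ℚ E := NormedAlgebra.restrictScalars ℚ ℝ E
  let _ : NormedAlgebra ℚ (E →L[ℝ] E) := NormedAlgebra.restrictScalars ℚ ℝ _
  -- left and right multiplication by `A`; their difference is the commutator with `A`
  let l : E →L[ℝ] E := ContinuousLinearMap.mul ℝ E A
  let r : E →L[ℝ] E := (ContinuousLinearMap.mul ℝ E).flip A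
  have hcomm : Commute (l - r) r := by
    ext x
    simp [l, r, sub_mul, mul_sub, mul_assoc]
  have hpowl : ∀ n : ℕ, ∀ x, (l ^ n) x = A ^ n * x := by
    intro n
    induction n with
    | zero => simp
    | succ n ih => intro x; rw [pow_succ', pow_succ']; simp [ih, l, mul_assoc]
  have hpowr : ∀ n : ℕ, ∀ x, (r ^ n) x = x * A ^ n := by
    intro n
    induction n with
    | zero => simp
    | succ n ih => intro x; rw [pow_succ', pow_succ]; simp [ih, r, mul_assoc]
  have hl : ∀ x, NormedSpace.exp l x = NormedSpace.exp A * x := by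
    intro x
    have h1 := (NormedSpace.exp_series_hasSum_exp' (𝕂 := ℝ) l).mapL
      (ContinuousLinearMap.apply ℝ E x)
    have h2 := (NormedSpace.exp_series_hasSum_exp' (𝕂 := ℝ) A).mul_right x
    refine h1.unique ?_
    simpa [hpowl] using h2
  have hr : ∀ x, NormedSpace.exp r x = x * NormedSpace.exp A := by
    intro x
    have h1 := (NormedSpace.exp_series_hasSum_exp' (𝕂 := ℝ) r).mapL
      (ContinuousLinearMap.apply ℝ E x)
    have h2 := (NormedSpace.exp_series_hasSum_exp' (𝕂 := ℝ) A).mul_left x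
    refine h1.unique ?_
    simpa [hpowr] using h2
  have hpow : ∀ n : ℕ, ((l - r) ^ n) B ∈ L := by
    intro n
    induction n with
    | zero => simpa
    | succ n ih => rw [pow_succ']; exact hA _ ih
  refine ⟨NormedSpace.exp (l - r) B, ?_, ?_⟩
  · have h1 := (NormedSpace.exp_series_hasSum_exp' (𝕂 := ℝ) (l - r)).mapL
      (ContinuousLinearMap.apply ℝ E B)
    refine hL.mem_of_tendsto h1 (Eventually.of_forall fun s => L.sum_mem fun n _ => ?_)
    simpa using L.smul_mem _ (hpow n)
  · rw [← hl, ← hr, ← mul_apply_eq_comp, ← NormedSpace.exp_add_of_commute hcomm.symm]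
    simp

/-- The product of exponentials `P t = exp (t₁ A₁) ⋯ exp (t_d A_d)` of elements of `L`: its logarithmic
derivatives lie in `L`, and those at `0` are the `A_i`. -/
theorem exists_prod_exp {E : Type*} [NormedRing E] [NormedAlgebra ℝ E] [CompleteSpace E]
    {L : Submodule ℝ E} (hL : IsClosed (L : Set E))
    (hLie : ∀ A ∈ L, ∀ B ∈ L, A * B - B * A ∈ L) (d : ℕ) (A : Fin d → E) (hA : ∀ i, A i ∈ L) :
    ∃ P : (Fin d → ℝ) → E, ContDiff ℝ ω P ∧ P 0 = 1 ∧
      (∀ t v, ∃ B ∈ L, fderiv ℝ P t v = B * P t) ∧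
      ∀ v, fderiv ℝ P 0 v = ∑ i, v i • A i := by
  let _ : NormedAlgebra ℚ E := NormedAlgebra.restrictScalars ℚ ℝ E
  induction d with
  | zero =>
    refine ⟨fun _ => 1, contDiff_const, rfl, fun t v => ⟨0, L.zero_mem, by simp⟩, fun v => ?_⟩
    simp
  | succ d ih =>
    obtain ⟨P, hP, hP0, hPL, hPd⟩ := ih (fun i => A i.succ) fun i => hA _
    let τ : (Fin (d + 1) → ℝ) →L[ℝ] (Fin d → ℝ) :=
      ContinuousLinearMap.pi fun i => ContinuousLinearMap.proj i.succ
    have hderiv : ∀ t, HasFDerivAt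
        (fun t : Fin (d + 1) → ℝ => NormedSpace.exp (t 0 • A 0) * P (τ t))
        (NormedSpace.exp (t 0 • A 0) • ((fderiv ℝ P (τ t)).comp τ) +
          (((ContinuousLinearMap.proj 0 : (Fin (d + 1) → ℝ) →L[ℝ] ℝ)).smulRight
            (A 0 * NormedSpace.exp (t 0 • A 0))) <• P (τ t)) t := by
      intro t
      have h1 : HasFDerivAt (fun t : Fin (d + 1) → ℝ => P (τ t)) ((fderiv ℝ P (τ t)).comp τ) t :=
        ((hP.differentiable (by simp)).differentiableAt.hasFDerivAt (x := τ t)).comp t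
          τ.hasFDerivAt
      have h2 : HasFDerivAt (fun t : Fin (d + 1) → ℝ => NormedSpace.exp (t 0 • A 0))
          (((ContinuousLinearMap.proj 0 : (Fin (d + 1) → ℝ) →L[ℝ] ℝ)).smulRight
            (A 0 * NormedSpace.exp (t 0 • A 0))) t := by
        have h3 := (hasDerivAt_exp_smul_const' (𝕂 := ℝ) (A 0) (t 0)).hasFDerivAt.comp t
          (ContinuousLinearMap.proj 0 : (Fin (d + 1) → ℝ) →L[ℝ] ℝ).hasFDerivAt
        refine h3.congr_fderiv ?_
        ext v
        simp
      exact h2.mul' h1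
    refine ⟨fun t => NormedSpace.exp (t 0 • A 0) * P (τ t), ?_, ?_, ?_, ?_⟩
    · have hexp : ContDiff ℝ ω (NormedSpace.exp : E → E) := by
        rw [← contDiffOn_univ]
        exact AnalyticOnNhd.contDiffOn (fun x _ => NormedSpace.exp_analytic x) uniqueDiffOn_univ
      refine ContDiff.mul (hexp.comp ?_) (hP.comp τ.contDiff)
      fun_prop
    · simp [hP0]
    · intro t v
      obtain ⟨B, hB, hBe⟩ := hPL (τ t) (τ v)
      obtain ⟨B', hB', hBe'⟩ := exists_exp_mul_eq_mul_exp hL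
        (hLie (t 0 • A 0) (L.smul_mem _ (hA 0))) hB
      refine ⟨B' + v 0 • A 0, L.add_mem hB' (L.smul_mem _ (hA 0)), ?_⟩
      rw [(hderiv t).fderiv]
      simp [hBe, ← mul_assoc, hBe', add_mul]
    · intro v
      rw [(hderiv 0).fderiv]
      simp [hP0, hPd, Fin.sum_univ_succ, add_comm]
      rfl

/-- The tangent space `L w = {A w | A ∈ L}` at `w` of the orbit of the linear action of `L`. -/
noncomputable def orbitTangent (L : Submodule ℝ (W →L[ℝ] W)) (w : W) : Submodule ℝ W :=
  L.map (ContinuousLinearMap.apply ℝ W w : (W →L[ℝ] W) →ₗ[ℝ] W)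

theorem mem_orbitTangent {L : Submodule ℝ (W →L[ℝ] W)} {w y : W} :
    y ∈ orbitTangent L w ↔ ∃ A ∈ L, A w = y := Iff.rfl

/-- `F` is a local system of invariants near `x` of the linear Lie algebra `L`: it is smooth at `x`,
its components have independent differentials at `x`, and these vanish on the tangent space of the
orbit of `x`. -/
structure IsInvariantSubmersionAt {k : ℕ} (L : Submodule ℝ (W →L[ℝ] W)) (F : W → Fin k → ℝ)
    (x : W) : Prop where
  smooth : ContDiffAt ℝ ∞ F x
  surjective : Function.Surjective (fderiv ℝ F x)
  annihilated : ∀ A ∈ L, fderiv ℝ F x (A x) = 0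

/-- Near a point where the dimension of the orbits of a linear Lie algebra is locally maximal, there
are as many independent invariants as the orbits have codimension. -/
theorem exists_isInvariantSubmersionAt [FiniteDimensional ℝ W] {L : Submodule ℝ (W →L[ℝ] W)}
    (hLie : ∀ A ∈ L, ∀ B ∈ L, A * B - B * A ∈ L) {w : W} {d k : ℕ}
    (hd : Module.finrank ℝ (orbitTangent L w) = d)
    (hmax : ∀ᶠ x in 𝓝 w, Module.finrank ℝ (orbitTangent L x) ≤ d)
    (hk : k + d = Module.finrank ℝ W) :
    ∃ F : W → Fin k → ℝ, ∀ᶠ x in 𝓝 w, IsInvariantSubmersionAt L F x := by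
  obtain ⟨N, hN⟩ := (orbitTangent L w).exists_isCompl
  have hNk : Module.finrank ℝ N = k := by
    have := Submodule.finrank_add_eq_of_isCompl hN
    omega
  let b := Module.finBasisOfFinrankEq ℝ (orbitTangent L w) hd
  let ν := Module.finBasisOfFinrankEq ℝ N hNk
  choose A hAL hAb using fun i => mem_orbitTangent.1 (b i).2
  have hLc : IsClosed (L : Set (W →L[ℝ] W)) := L.closed_of_finiteDimensional
  obtain ⟨P, hP, hP0, hPL, hPd⟩ := exists_prod_exp hLc hLie d A hAL
  -- the derivative at `0` of the parametrization `Φ` below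
  let ψ : ((Fin d → ℝ) × (Fin k → ℝ)) ≃L[ℝ] W :=
    ((b.equivFun.symm.prodCongr ν.equivFun.symm).trans
      (Submodule.prodEquivOfIsCompl _ _ hN)).toContinuousLinearEquiv
  have hψ : ∀ v, ψ (v, 0) = ∑ i, v i • (b i : W) := by
    intro v
    simp [ψ, Module.Basis.equivFun_symm_apply]
  let Q : ((Fin d → ℝ) × (Fin k → ℝ)) →L[ℝ] W :=
    (ψ : _ →L[ℝ] W).comp ((ContinuousLinearMap.inr ℝ (Fin d → ℝ) (Fin k → ℝ)).comp
      (ContinuousLinearMap.snd ℝ (Fin d → ℝ) (Fin k → ℝ)))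
  let Φ : ((Fin d → ℝ) × (Fin k → ℝ)) → W := fun p => P p.1 (w + Q p)
  have hΦd : ∀ p, HasFDerivAt Φ ((P p.1).comp Q +
      ((fderiv ℝ P p.1).comp (ContinuousLinearMap.fst ℝ _ _)).flip (w + Q p)) p := by
    intro p
    have h1 : HasFDerivAt (fun p : (Fin d → ℝ) × (Fin k → ℝ) => P p.1)
        ((fderiv ℝ P p.1).comp (ContinuousLinearMap.fst ℝ _ _)) p :=
      ((hP.differentiable (by simp)).differentiableAt.hasFDerivAt).comp p hasFDerivAt_fst
    exact h1.clm_apply (Q.hasFDerivAt.const_add w)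
  have hΦ : ContDiff ℝ ω Φ :=
    (hP.comp contDiff_fst).clm_apply (contDiff_const.add Q.contDiff)
  have hΦ0 : Φ 0 = w := by simp [Φ, hP0]
  have hΦψ : HasFDerivAt Φ (ψ : _ →L[ℝ] W) 0 := by
    refine (hΦd 0).congr_fderiv ?_
    ext p
    · simp [hPd, Q, hP0, hψ, hAb]
    · simp [Q, hP0]
  let G := hΦ.contDiffAt.localInverse hΦψ (by simp)
  have hG : ContDiffAt ℝ ω G w := by
    have := hΦ.contDiffAt.to_localInverse hΦψ (by simp)
    rwa [hΦ0] at this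
  have hst := hΦ.contDiffAt.hasStrictFDerivAt' hΦψ (by simp)
  have hright : ∀ᶠ x in 𝓝 w, Φ (G x) = x := by
    have := hst.eventually_right_inverse
    rwa [hΦ0] at this
  have hGw : G w = 0 := by
    have := hst.localInverse_apply_image
    rwa [hΦ0] at this
  have hleft : ∀ᶠ x in 𝓝 w, ∀ᶠ p in 𝓝 (G x), G (Φ p) = p := by
    have h0 : ∀ᶠ p in 𝓝 (0 : (Fin d → ℝ) × (Fin k → ℝ)), G (Φ p) = p :=
      hst.eventually_left_inverse
    have h1 := eventually_eventually_nhds.2 h0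
    rw [← hGw] at h1
    exact hG.continuousAt.eventually h1
  -- the invariants are the transversal components of the local inverse of `Φ`
  refine ⟨fun x => (G x).2, ?_⟩
  filter_upwards [hright, hleft, hmax, hG.eventually (by simp)] with x hx hlx hmx hGx
  set p := G x with hp
  have hGd : HasFDerivAt G (fderiv ℝ G x) x := (hGx.differentiableAt (by simp)).hasFDerivAt
  have hFd : HasFDerivAt (fun x => (G x).2)
      ((ContinuousLinearMap.snd ℝ _ _).comp (fderiv ℝ G x)) x := hGd.snd
  have hinv : ∀ q, fderiv ℝ G x (P p.1 (Q q) + fderiv ℝ P p.1 q.1 (w + Q p)) = q := by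
    intro q
    have h1 := hΦd p
    rw [← hx] at hGd
    have h2 := (hGd.comp p h1).congr_of_eventuallyEq (hlx.mono fun y hy => hy.symm)
    have h3 := h2.unique (hasFDerivAt_id p)
    have h4 := congrArg (fun f => f q) h3
    rw [hx] at h4
    simpa using h4
  refine ⟨contDiff_snd.contDiffAt.comp x (hGx.of_le (by simp)), ?_, ?_⟩
  · intro c
    refine ⟨P p.1 (Q (0, c)) + fderiv ℝ P p.1 0 (w + Q p), ?_⟩
    rw [hFd.fderiv]
    have := hinv (0, c)
    simp only [ContinuousLinearMap.comp_apply]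
    rw [this]
    rfl
  -- the fibre directions of `Φ` are tangent to the orbit, and fill its tangent space for reasons of
  -- dimension, by the maximality of `d`
  · let J : (Fin d → ℝ) →ₗ[ℝ] W :=
      ((fderiv ℝ P p.1).flip (w + Q p) : (Fin d → ℝ) →L[ℝ] W)
    have hJ : ∀ v, fderiv ℝ G x (J v) = (v, 0) := by
      intro v
      have := hinv (v, 0)
      have hQ : Q (v, 0) = 0 := by
        simp only [Q, ContinuousLinearMap.comp_apply]
        simp
      rw [hQ] at this
      simpa [J] using this
    have hinj : Function.Injective J := by
      intro v v' h
      have := congrArg (fun y => (fderiv ℝ G x y).1) h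
      simpa [hJ] using this
    have hle : LinearMap.range J ≤ orbitTangent L x := by
      rintro _ ⟨v, rfl⟩
      obtain ⟨B, hB, hBe⟩ := hPL p.1 v
      refine mem_orbitTangent.2 ⟨B, hB, ?_⟩
      have hx' : P p.1 (w + Q p) = x := hx
      simp only [J, ContinuousLinearMap.coe_coe, ContinuousLinearMap.flip_apply, hBe]
      rw [mul_apply_eq_comp, hx']
    have heq : LinearMap.range J = orbitTangent L x := by
      refine Submodule.eq_of_le_of_finrank_le hle ?_
      rw [LinearMap.finrank_range_of_inj hinj]
      simpa using hmx
    intro B hB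
    have hBx : B x ∈ LinearMap.range J := heq ▸ mem_orbitTangent.2 ⟨B, hB, rfl⟩
    obtain ⟨v, hv⟩ := hBx
    rw [hFd.fderiv, ← hv]
    simp [hJ]

end LinearFrobenius

/-! ### Gluing local solutions on a dense open set -/

/-- A condition on germs of maps that can be satisfied on some open subset of each nonempty open
set can be satisfied by a single map on a dense open set. -/
theorem exists_dense_of_local {X Y : Type*} [TopologicalSpace X] [Nonempty Y]
    (P : X → (X → Y) → Prop) (hP : ∀ x F G, F =ᶠ[𝓝 x] G → P x F → P x G)
    (hloc : ∀ V : Set X, IsOpen V → V.Nonempty →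
      ∃ O ⊆ V, IsOpen O ∧ O.Nonempty ∧ ∃ F, ∀ x ∈ O, P x F) :
    ∃ U : Set X, IsOpen U ∧ Dense U ∧ ∃ F, ∀ x ∈ U, P x F := by
  classical
  let good : Set (Set X) := {O | IsOpen O ∧ ∃ F, ∀ x ∈ O, P x F}
  obtain ⟨S, hS⟩ := zorn_subset {S : Set (Set X) | S ⊆ good ∧ S.PairwiseDisjoint id} (by
    intro c hc hchain
    refine ⟨⋃₀ c, ⟨Set.sUnion_subset fun s hs => (hc hs).1, ?_⟩, fun s hs =>
      Set.subset_sUnion_of_mem hs⟩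
    exact (Set.pairwiseDisjoint_sUnion hchain.directedOn).2 fun s hs => (hc hs).2)
  have hSg := hS.prop.1
  have hSd := hS.prop.2
  choose! f hf using fun O (hO : O ∈ S) => (hSg hO).2
  refine ⟨⋃₀ S, isOpen_sUnion fun O hO => (hSg hO).1, ?_,
    fun x => if h : ∃ O ∈ S, x ∈ O then f h.choose x else Classical.arbitrary Y, ?_⟩
  · rw [dense_iff_inter_open]
    intro V hV hVne
    by_contra hempty
    rw [Set.not_nonempty_iff_eq_empty] at hempty
    obtain ⟨O, hOV, hO, ⟨x, hx⟩, F, hF⟩ := hloc V hV hVne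
    have hdisj : ∀ O' ∈ S, Disjoint O O' := by
      intro O' hO'
      rw [Set.disjoint_left]
      intro y hy hy'
      exact (hempty ▸ (⟨hOV hy, O', hO', hy'⟩ : y ∈ V ∩ ⋃₀ S) : y ∈ (∅ : Set X))
    have hmem : O ∈ S := by
      have hins : insert O S ∈ {S : Set (Set X) | S ⊆ good ∧ S.PairwiseDisjoint id} :=
        ⟨Set.insert_subset ⟨hO, F, hF⟩ hSg, hSd.insert fun O' hO' _ => hdisj O' hO'⟩
      exact hS.le_of_ge hins (Set.subset_insert O S) (Set.mem_insert O S)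
    exact Set.disjoint_left.1 (hdisj O hmem) hx hx
  · rintro x ⟨O, hO, hx⟩
    refine hP x (f O) _ ?_ (hf O hO x hx)
    filter_upwards [(hSg hO).1.mem_nhds hx] with y hy
    have h : ∃ O ∈ S, y ∈ O := ⟨O, hO, hy⟩
    rw [dif_pos h]
    have : O = h.choose := hSd.elim_set hO h.choose_spec.1 y hy h.choose_spec.2
    rw [← this]

/-! ### Local maxima of the dimension of the orbits -/

/-- If the dimension of the orbits is locally maximal at `w`, the stabilizer of `w` maps the whole
space into the tangent space of the orbit: otherwise `A y` would enlarge the tangent space at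
`w + t y`, for small `t ≠ 0`. -/
theorem apply_mem_orbitTangent_of_isLocalMax {W : Type*} [NormedAddCommGroup W] [NormedSpace ℝ W]
    [FiniteDimensional ℝ W] {L : Submodule ℝ (W →L[ℝ] W)} {w : W}
    (hmax : ∀ᶠ x in 𝓝 w,
      Module.finrank ℝ (orbitTangent L x) ≤ Module.finrank ℝ (orbitTangent L w))
    {A : W →L[ℝ] W} (hA : A ∈ L) (hAw : A w = 0) (y : W) : A y ∈ orbitTangent L w := by
  by_contra hy
  let b := Module.finBasis ℝ (orbitTangent L w)
  choose B hBL hBb using fun i => mem_orbitTangent.1 (b i).2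
  let g : ℝ → Fin (Module.finrank ℝ (orbitTangent L w) + 1) → W :=
    fun t => Fin.cons (A y) fun i => B i (w + t • y)
  have hg : Continuous g := by
    refine continuous_pi fun i => ?_
    refine Fin.cases ?_ (fun i => ?_) i
    · simpa [g] using continuous_const
    · simp only [g, Fin.cons_succ]
      fun_prop
  have hb : LinearIndependent ℝ fun i => (b i : W) :=
    b.linearIndependent.map' (orbitTangent L w).subtype (Submodule.ker_subtype _)
  have h0 : LinearIndependent ℝ (g 0) := by
    simp only [g, zero_smul, add_zero, hBb]
    refine linearIndependent_finCons.2 ⟨hb, fun h => hy ?_⟩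
    refine Submodule.span_le.2 ?_ h
    rintro _ ⟨i, rfl⟩
    exact (b i).2
  have hev : ∀ᶠ t in 𝓝 (0 : ℝ), LinearIndependent ℝ (g t) :=
    hg.continuousAt.eventually (isOpen_setOfPred_linearIndependent.mem_nhds h0)
  have hcont : ContinuousAt (fun t : ℝ => w + t • y) 0 := by fun_prop
  have hmax' : ∀ᶠ t in 𝓝 (0 : ℝ), Module.finrank ℝ (orbitTangent L (w + t • y)) ≤
      Module.finrank ℝ (orbitTangent L w) := by
    refine hcont.eventually (p := fun x => Module.finrank ℝ (orbitTangent L x) ≤ _) ?_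
    simpa using hmax
  have hne : ∀ᶠ t in 𝓝[≠] (0 : ℝ), t ≠ 0 := eventually_mem_nhdsWithin
  obtain ⟨t, ⟨ht, htm⟩, ht0⟩ :=
    (((hev.and hmax').filter_mono nhdsWithin_le_nhds).and hne).exists
  have hle : Submodule.span ℝ (Set.range (g t)) ≤ orbitTangent L (w + t • y) := by
    refine Submodule.span_le.2 ?_
    rintro _ ⟨i, rfl⟩
    refine Fin.cases ?_ (fun i => ?_) i
    · refine mem_orbitTangent.2 ⟨t⁻¹ • A, L.smul_mem _ hA, ?_⟩
      simp [g, hAw, smul_smul, inv_mul_cancel₀ ht0]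
    · exact mem_orbitTangent.2 ⟨B i, hBL i, by simp [g]⟩
  have h1 := Submodule.finrank_mono hle
  rw [finrank_span_eq_card ht] at h1
  simp at h1
  omega

/-! ### Completing elements of `sl₂` to triples -/

section Sl2

variable {K : Type*} [Field K] [CharZero K]

/-- An element of `sl₂` of determinant `-1` is the semisimple element of a triple, which again spans:
a subspace that contains the new triple contains the old one. -/
theorem _root_.IsSl2Triple.exists_triple_of_sq_eq_one {L : Type*} [LieRing L] [LieAlgebra K L]
    {h e f : L} (t : IsSl2Triple h e f) {a b c : K} (hq : a ^ 2 + b * c = 1) :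
    ∃ e' f', IsSl2Triple (a • h + b • e + c • f) e' f' ∧ ∀ N : Submodule K L,
      a • h + b • e + c • f ∈ N → e' ∈ N → f' ∈ N → h ∈ N ∧ e ∈ N ∧ f ∈ N := by
  have key : ∀ {h e f : L} (t : IsSl2Triple h e f) {a b c : K} (hq : a ^ 2 + b * c = 1)
      (hb : b ≠ 0), ∃ e' f', IsSl2Triple (a • h + b • e + c • f) e' f' ∧ ∀ N : Submodule K L,
      a • h + b • e + c • f ∈ N → e' ∈ N → f' ∈ N → h ∈ N ∧ e ∈ N ∧ f ∈ N := by
    intro h e f t a b c hq hb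
    -- `e'` and `f'` are the matrix units in a basis of eigenvectors of the matrix `(a, b; c, -a)`
    have hc : c = (1 - a ^ 2) / b := by field_simp; linear_combination hq
    have hhe : ⁅h, e⁆ = (2 : K) • e := t.lie_h_e_smul K
    have hhf : ⁅h, f⁆ = -((2 : K) • f) := t.lie_lie_smul_f K
    have hef := t.lie_e_f
    have heh : ⁅e, h⁆ = -((2 : K) • e) := by rw [← lie_skew, hhe]
    have hfh : ⁅f, h⁆ = (2 : K) • f := by rw [← lie_skew, hhf, neg_neg]
    have hfe : ⁅f, e⁆ = -h := by rw [← lie_skew, hef]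
    refine ⟨((1 - a) / 2) • h + (-b / 2) • e + ((1 - a) ^ 2 / (2 * b)) • f,
      ((1 + a) / 2) • h + (b / 2) • e + (-(1 + a) ^ 2 / (2 * b)) • f, ⟨?_, ?_, ?_, ?_⟩, ?_⟩
    · intro h0
      have h1 : ⁅f, ⁅f, a • h + b • e + c • f⁆⁆ = (-2 * b) • f := by
        simp only [lie_add, lie_smul, lie_neg, hfh, hfe, lie_self, lie_zero]
        module
      rw [h0, lie_zero, lie_zero] at h1
      exact (smul_ne_zero (mul_ne_zero (by norm_num) hb) t.f_ne_zero) h1.symm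
    · simp only [add_lie, smul_lie, lie_add, lie_smul, hhe, hhf, hef, heh, hfh, hfe, lie_self, hc]
      match_scalars <;> field_simp <;> ring
    · simp only [add_lie, smul_lie, lie_add, lie_smul, hhe, hhf, hef, heh, hfh, hfe, lie_self, hc]
      match_scalars <;> field_simp <;> ring
    · simp only [add_lie, smul_lie, lie_add, lie_smul, hhe, hhf, hef, heh, hfh, hfe, lie_self, hc]
      match_scalars <;> field_simp <;> ring
    · intro N hX hE hF
      have hfN : f ∈ N := by
        have := N.smul_mem (b / 2) (N.add_mem (N.sub_mem hX hF) hE)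
        convert! this using 1
        rw [hc]
        match_scalars <;> field_simp <;> ring
      have hhN : h ∈ N := by
        have := N.add_mem (N.add_mem hE hF) (N.smul_mem (2 * a / b) hfN)
        convert! this using 1
        match_scalars <;> field_simp <;> ring
      refine ⟨hhN, ?_, hfN⟩
      have := N.smul_mem b⁻¹ (N.sub_mem (N.sub_mem hX (N.smul_mem a hhN)) (N.smul_mem c hfN))
      convert! this using 1
      match_scalars <;> field_simp <;> ring
  by_cases hb : b = 0
  · by_cases hc : c = 0
    · subst hb hc
      have ha : a = 1 ∨ a = -1 := by
        have : (a - 1) * (a + 1) = 0 := by linear_combination hq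
        rcases mul_eq_zero.1 this with h | h
        · exact Or.inl (sub_eq_zero.1 h)
        · exact Or.inr (eq_neg_of_add_eq_zero_left h)
      rcases ha with rfl | rfl
      · exact ⟨e, f, by simpa using t, fun N h1 h2 h3 => ⟨by simpa using h1, h2, h3⟩⟩
      · exact ⟨f, e, by simpa using t.symm, fun N h1 h2 h3 => ⟨by simpa using h1, h3, h2⟩⟩
    · obtain ⟨e', f', ht, hN⟩ := key t.symm (a := -a) (b := c) (c := b)
        (by rw [← hq]; ring) hc
      have he : (-a) • -h + c • f + b • e = a • h + b • e + c • f := by module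
      rw [he] at ht hN
      refine ⟨e', f', ht, fun N h1 h2 h3 => ?_⟩
      obtain ⟨h4, h5, h6⟩ := hN N h1 h2 h3
      exact ⟨by simpa using h4, h6, h5⟩
  · exact key t hq hb

/-- A nonzero element of `sl₂` of determinant `0` is the nilpotent element of a triple, which again
spans. -/
theorem _root_.IsSl2Triple.exists_triple_of_sq_eq_zero {L : Type*} [LieRing L] [LieAlgebra K L]
    {h e f : L} (t : IsSl2Triple h e f) {a b c : K} (hq : a ^ 2 + b * c = 0)
    (hne : a • h + b • e + c • f ≠ 0) :
    ∃ h' f', IsSl2Triple h' (a • h + b • e + c • f) f' ∧ ∀ N : Submodule K L,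
      h' ∈ N → a • h + b • e + c • f ∈ N → f' ∈ N → h ∈ N ∧ e ∈ N ∧ f ∈ N := by
  have key : ∀ {h e f : L} (t : IsSl2Triple h e f) {a b c : K} (hq : a ^ 2 + b * c = 0)
      (hb : b ≠ 0), ∃ h' f', IsSl2Triple h' (a • h + b • e + c • f) f' ∧ ∀ N : Submodule K L,
      h' ∈ N → a • h + b • e + c • f ∈ N → f' ∈ N → h ∈ N ∧ e ∈ N ∧ f ∈ N := by
    intro h e f t a b c hq hb
    have hc : c = - a ^ 2 / b := by field_simp; linear_combination hq
    have hhe : ⁅h, e⁆ = (2 : K) • e := t.lie_h_e_smul K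
    have hhf : ⁅h, f⁆ = -((2 : K) • f) := t.lie_lie_smul_f K
    have hef := t.lie_e_f
    have heh : ⁅e, h⁆ = -((2 : K) • e) := by rw [← lie_skew, hhe]
    have hfh : ⁅f, h⁆ = (2 : K) • f := by rw [← lie_skew, hhf, neg_neg]
    have hfe : ⁅f, e⁆ = -h := by rw [← lie_skew, hef]
    refine ⟨h + (-(2 * a) / b) • f, b⁻¹ • f, ⟨?_, ?_, ?_, ?_⟩, ?_⟩
    · intro h0
      have h1 : ⁅f, h + (-(2 * a) / b) • f⁆ = (2 : K) • f := by
        simp [lie_add, lie_smul, hfh]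
      rw [h0, lie_zero] at h1
      exact (smul_ne_zero (by norm_num) t.f_ne_zero) h1.symm
    · simp only [add_lie, smul_lie, lie_smul, hhf, hef, lie_self, hc]
      match_scalars <;> field_simp
    · rw [← Nat.cast_smul_eq_nsmul K]
      simp only [add_lie, smul_lie, lie_add, lie_smul, hhe, hhf, hfh, hfe, lie_self, hc]
      match_scalars <;> field_simp <;> ring
    · rw [← Nat.cast_smul_eq_nsmul K]
      simp only [add_lie, smul_lie, lie_smul, hhf, lie_self]
      match_scalars; field_simp
    · intro N hh hX hF
      have hfN : f ∈ N := by
        have := N.smul_mem b hF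
        rwa [smul_smul, mul_inv_cancel₀ hb, one_smul] at this
      have hhN : h ∈ N := by
        have := N.add_mem hh (N.smul_mem (2 * a / b) hfN)
        convert! this using 1
        match_scalars <;> field_simp <;> ring
      refine ⟨hhN, ?_, hfN⟩
      have := N.smul_mem b⁻¹ (N.sub_mem (N.sub_mem hX (N.smul_mem a hhN)) (N.smul_mem c hfN))
      convert! this using 1
      match_scalars <;> field_simp <;> ring
  by_cases hb : b = 0
  · by_cases hc : c = 0
    · subst hb hc
      simp_all
    · obtain ⟨h', f', ht, hN⟩ := key t.symm (a := -a) (b := c) (c := b)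
        (by rw [← hq]; ring) hc
      have he : (-a) • -h + c • f + b • e = a • h + b • e + c • f := by module
      rw [he] at ht hN
      refine ⟨h', f', ht, fun N h1 h2 h3 => ?_⟩
      obtain ⟨h4, h5, h6⟩ := hN N h1 h2 h3
      exact ⟨by simpa using h4, h6, h5⟩
  · exact key t hq hb

end Sl2

attribute [local instance] LieRing.ofAssociativeRing

/-! ### Ranks in representations of `sl₂` -/

section Sl2Module

variable {K : Type*} [Field K] [CharZero K] {W : Type*} [AddCommGroup W] [Module K W]
  [FiniteDimensional K W]

theorem _root_.IsSl2Triple.apply_eq_zero_of_weight_zero {h e f : Module.End K W}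
    (t : IsSl2Triple h e f) {v : W} (hh : h v = 0) (he : e v = 0) : f v = 0 := by
  by_cases hv : v = 0
  · simp [hv]
  have P : t.HasPrimitiveVectorWith v (0 : K) := ⟨hv, by simpa using hh, by simpa using he⟩
  simpa using P.pow_toEnd_f_eq_zero_of_eq_nat (n := 0) (by simp)

/-- As `e` maps the weight space `0` to the weight space `2`, it has a kernel on the former when the
latter is smaller. -/
theorem _root_.IsSl2Triple.exists_invariant_of_finrank_eigenspace_le {h e f : Module.End K W}
    (t : IsSl2Triple h e f) (h0 : 2 ≤ Module.finrank K (LinearMap.ker h))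
    (h2 : Module.finrank K (h.eigenspace 2) ≤ 1) :
    ∃ v ≠ 0, h v = 0 ∧ e v = 0 ∧ f v = 0 := by
  have hcomm : ∀ v, h (e v) = e (h v) + (2 : K) • e v := by
    intro v
    have := congrArg (fun T : Module.End K W => T v) (t.lie_h_e_smul K)
    simp only [Ring.lie_def, LinearMap.sub_apply, Module.End.mul_apply, LinearMap.smul_apply] at this
    rw [← this]; abel
  let g : LinearMap.ker h →ₗ[K] h.eigenspace 2 :=
    (e.comp (LinearMap.ker h).subtype).codRestrict _ fun v => by
      rw [Module.End.mem_eigenspace_iff]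
      simp [hcomm]
  obtain ⟨v, hv, hv0⟩ := Submodule.exists_mem_ne_zero_of_ne_bot
    (LinearMap.ker_ne_bot_of_finrank_lt (f := g) (by omega))
  have hev : e v = 0 := congrArg Subtype.val (LinearMap.mem_ker.1 hv)
  have hhv : h v = 0 := v.2
  exact ⟨v, by simpa using hv0, hhv, hev, t.apply_eq_zero_of_weight_zero hhv hev⟩

/-- If `h` has rank at most 2, one of the weight spaces `2` and `-2` has dimension at most 1, while
the weight space `0` has dimension at least 2. -/
theorem _root_.IsSl2Triple.exists_invariant_of_finrank_range_h_le {h e f : Module.End K W}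
    (t : IsSl2Triple h e f) (hW : 4 ≤ Module.finrank K W)
    (hr : Module.finrank K (LinearMap.range h) ≤ 2) :
    ∃ v ≠ 0, h v = 0 ∧ e v = 0 ∧ f v = 0 := by
  have hrk := LinearMap.finrank_range_add_finrank_ker h
  have hle : ∀ μ : K, μ ≠ 0 → h.eigenspace μ ≤ LinearMap.range h := by
    intro μ hμ v hv
    rw [Module.End.mem_eigenspace_iff] at hv
    exact ⟨μ⁻¹ • v, by rw [map_smul, hv, smul_smul, inv_mul_cancel₀ hμ, one_smul]⟩
  have hinf : h.eigenspace 2 ⊓ h.eigenspace (-2) = ⊥ := by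
    rw [eq_bot_iff]
    rintro v ⟨h1, h2⟩
    rw [SetLike.mem_coe, Module.End.mem_eigenspace_iff] at h1 h2
    rw [h1] at h2
    have h4 : (4 : K) • v = 0 := by
      have : (4 : K) • v = (2 : K) • v - (-2 : K) • v := by module
      rw [this, h2, sub_self]
    simpa using h4
  have hsum := Submodule.finrank_sup_add_finrank_inf_eq (h.eigenspace 2) (h.eigenspace (-2))
  rw [hinf, finrank_bot] at hsum
  have hsup := Submodule.finrank_mono (sup_le (hle 2 (by norm_num)) (hle (-2) (by norm_num)))
  by_cases h2 : Module.finrank K (h.eigenspace 2) ≤ 1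
  · exact t.exists_invariant_of_finrank_eigenspace_le (by omega) h2
  · have hneg : (-h).eigenspace 2 = h.eigenspace (-2) := by
      ext v
      simp [neg_eq_iff_eq_neg]
    have hker : LinearMap.ker (-h) = LinearMap.ker h := by ext; simp
    obtain ⟨v, hv, h1, h2, h3⟩ := t.symm.exists_invariant_of_finrank_eigenspace_le
      (by rw [hker]; omega) (by rw [hneg]; omega)
    exact ⟨v, hv, by simpa using h1, h3, h2⟩

/-- In an irreducible representation of dimension at least 4 the nilpotent element `e` has rank at
least 3. Otherwise `h` is bijective on `ker e`, which gives `ker e = range e`, and then every vector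
of `ker e` is primitive of weight 1 and generates a representation of dimension at most 2. -/
theorem _root_.IsSl2Triple.lt_finrank_range_e {h e f : Module.End K W}
    (t : IsSl2Triple h e f) (hW : 4 ≤ Module.finrank K W)
    (hirr : ∀ N : Submodule K W, (∀ v ∈ N, h v ∈ N ∧ e v ∈ N ∧ f v ∈ N) → N = ⊥ ∨ N = ⊤) :
    2 < Module.finrank K (LinearMap.range e) := by
  by_contra! hr
  have hhe : ∀ v, h (e v) = e (h v) + (2 : K) • e v := by
    intro v
    have := congrArg (fun T : Module.End K W => T v) (t.lie_h_e_smul K)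
    simp only [Ring.lie_def, LinearMap.sub_apply, Module.End.mul_apply, LinearMap.smul_apply] at this
    rw [← this]; abel
  have hef : ∀ v, e (f v) = f (e v) + h v := by
    intro v
    have := congrArg (fun T : Module.End K W => T v) t.lie_e_f
    simp only [Ring.lie_def, LinearMap.sub_apply, Module.End.mul_apply] at this
    rw [← this]; abel
  -- a proper submodule spanned by at most two vectors vanishes
  have hsmall : ∀ v w : W, (∀ x ∈ Submodule.span K {v, w},
      h x ∈ Submodule.span K {v, w} ∧ e x ∈ Submodule.span K {v, w} ∧
        f x ∈ Submodule.span K {v, w}) → v = 0 := by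
    intro v w hvw
    rcases hirr _ hvw with h1 | h1
    · have : v ∈ Submodule.span K {v, w} := Submodule.subset_span (by simp)
      rw [h1] at this
      simpa using this
    · classical
      have h2 := finrank_span_finset_le_card (R := K) ({v, w} : Finset W)
      have h3 : ({v, w} : Finset W).card ≤ 2 := Finset.card_le_two
      rw [Set.finrank, Finset.coe_pair, h1, finrank_top] at h2
      omega
  have hrk := LinearMap.finrank_range_add_finrank_ker e
  -- `h` acts injectively on `ker e`
  have hmaps : ∀ v ∈ LinearMap.ker e, h v ∈ LinearMap.ker e := by
    intro v hv
    rw [LinearMap.mem_ker] at hv ⊢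
    have := hhe v
    simpa [hv] using this.symm
  let hK : LinearMap.ker e →ₗ[K] LinearMap.ker e := h.restrict hmaps
  have hKinj : Function.Injective hK := by
    rw [← LinearMap.ker_eq_bot, LinearMap.ker_eq_bot']
    intro v hv
    have hhv : h v = 0 := congrArg Subtype.val hv
    have hev : e v = 0 := v.2
    have hfv := t.apply_eq_zero_of_weight_zero hhv hev
    refine Subtype.ext (hsmall v v fun x hx => ?_)
    obtain ⟨c, rfl⟩ : ∃ c : K, c • (v : W) = x := by
      simpa [Submodule.mem_span_singleton] using hx
    simp [hhv, hev, hfv]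
  have hKsurj : Function.Surjective hK := LinearMap.injective_iff_surjective.1 hKinj
  have hle : LinearMap.ker e ≤ LinearMap.range e := by
    intro v hv
    obtain ⟨u, hu⟩ := hKsurj ⟨v, hv⟩
    have hu' : h u = v := congrArg Subtype.val hu
    have hev : e u = 0 := u.2
    exact ⟨f u, by rw [hef, hev, map_zero, zero_add, hu']⟩
  have heq : LinearMap.ker e = LinearMap.range e :=
    Submodule.eq_of_le_of_finrank_le hle (by omega)
  have hee : ∀ v, e (e v) = 0 := by
    intro v
    have : e v ∈ LinearMap.ker e := heq ▸ LinearMap.mem_range_self e v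
    exact this
  obtain ⟨v, hv, hv0⟩ := Submodule.exists_mem_ne_zero_of_ne_bot
    (p := LinearMap.ker e) (by rw [Ne, ← Submodule.finrank_eq_zero (R := K)]; omega)
  obtain ⟨u, rfl⟩ := hle hv
  have hhv : h (e u) = e u := by
    have h1 := hef (e u)
    rw [hee, map_zero, zero_add] at h1
    have h2 : f (e u) = e (f u) - h u := by rw [hef]; abel
    rw [h2, map_sub, hee, zero_sub] at h1
    have h3 := hhe u
    have h4 : e (h u) = - h (e u) := by rw [← h1, neg_neg]
    rw [h4] at h3
    have h5 : (2 : K) • h (e u) = (2 : K) • e u := by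
      rw [two_smul]; nth_rewrite 1 [h3]; abel
    exact smul_right_injective W (two_ne_zero (α := K)) h5
  have P : t.HasPrimitiveVectorWith (e u) (1 : K) := ⟨hv0, by simpa using hhv, by simpa using hee u⟩
  have hff : f (f (e u)) = 0 := by
    simpa [pow_succ] using P.pow_toEnd_f_eq_zero_of_eq_nat (n := 1) (by simp)
  have hhf : h (f (e u)) = - f (e u) := by
    have := P.lie_h_pow_toEnd_f 1
    simp only [pow_one, LieModule.toEnd_apply_apply, Module.End.lie_apply] at this
    rw [this]; module
  have hef' : e (f (e u)) = e u := by rw [hef, hee, map_zero, zero_add, hhv]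
  refine hv0 (hsmall (e u) (f (e u)) fun x hx => ?_)
  obtain ⟨a, b, rfl⟩ := Submodule.mem_span_pair.1 hx
  simp only [Submodule.mem_span_pair, map_add, map_smul, hhv, hee, hff, hhf, hef']
  exact ⟨⟨a, -b, by module⟩, ⟨b, 0, by module⟩, ⟨0, a, by module⟩⟩

end Sl2Module

section Complexification

variable {V : Type*} [AddCommGroup V] [Module ℝ V]

/-- The common kernel of real operators remains zero after complexification. -/
theorem eq_zero_of_baseChange_eq_zero {ι : Type*} [Fintype ι] (T : ι → Module.End ℝ V)
    (hT : ∀ v, (∀ i, T i v = 0) → v = 0) {v : ℂ ⊗[ℝ] V}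
    (hv : ∀ i, (T i).baseChange ℂ v = 0) : v = 0 := by
  classical
  obtain ⟨g, hg⟩ := LinearMap.exists_leftInverse_of_injective (LinearMap.pi T)
    (LinearMap.ker_eq_bot'.2 fun v h => hT v fun i => congrFun h i)
  have hsum : ∑ i, (g.comp (LinearMap.single ℝ _ i)).comp (T i) = LinearMap.id := by
    rw [← hg]
    ext v
    simp only [LinearMap.sum_apply, LinearMap.comp_apply]
    rw [← map_sum]
    congr 1
    exact Finset.univ_sum_single (fun i => T i v)
  have h1 := congrArg (LinearMap.baseChange ℂ) hsum
  rw [← LinearMap.baseChangeHom_apply, map_sum] at h1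
  have h2 := congrArg (fun S => S v) h1
  simpa [LinearMap.baseChange_comp, hv] using h2.symm

theorem finrank_range_baseChange_le [FiniteDimensional ℝ V] (T : Module.End ℝ V) :
    Module.finrank ℂ (LinearMap.range (T.baseChange ℂ)) ≤ Module.finrank ℝ (LinearMap.range T) := by
  have h1 : T = (LinearMap.range T).subtype.comp T.rangeRestrict := rfl
  have h2 : LinearMap.range (T.baseChange ℂ) ≤
      LinearMap.range ((LinearMap.range T).subtype.baseChange ℂ) := by
    conv_lhs => rw [h1, LinearMap.baseChange_comp]
    exact LinearMap.range_comp_le_range _ _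
  refine (Submodule.finrank_mono h2).trans ((LinearMap.finrank_range_le _).trans ?_)
  rw [Module.finrank_baseChange]

/-- A real operator whose complexification is a semisimple element of an `sl₂` acting without
invariant vectors has rank at least 3. -/
theorem lt_finrank_range_of_baseChange_mem_sl2 [FiniteDimensional ℝ V] {h e f : Module.End ℂ (ℂ ⊗[ℝ] V)}
    (t : IsSl2Triple h e f) (hV : 4 ≤ Module.finrank ℝ V) {ι : Type*} [Fintype ι]
    (T : ι → Module.End ℝ V) (hT : ∀ v, (∀ i, T i v = 0) → v = 0)
    (hspan : ∀ N : Submodule ℂ (Module.End ℂ (ℂ ⊗[ℝ] V)), h ∈ N → e ∈ N → f ∈ N →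
      ∀ i, (T i).baseChange ℂ ∈ N)
    {a b c : ℂ} (hq : a ^ 2 + b * c ≠ 0) {S : Module.End ℝ V}
    (hS : S.baseChange ℂ = a • h + b • e + c • f) :
    2 < Module.finrank ℝ (LinearMap.range S) := by
  by_contra! hr
  obtain ⟨μ, hμ⟩ := IsAlgClosed.exists_pow_nat_eq (a ^ 2 + b * c) two_pos
  have hμ0 : μ ≠ 0 := by rintro rfl; simp at hμ; exact hq hμ.symm
  obtain ⟨e', f', t', hN⟩ := t.exists_triple_of_sq_eq_one (a := a / μ) (b := b / μ) (c := c / μ)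
    (by field_simp; exact hμ.symm)
  have hrange : Module.finrank ℂ (LinearMap.range ((a / μ) • h + (b / μ) • e + (c / μ) • f)) ≤ 2 := by
    have h1 : (a / μ) • h + (b / μ) • e + (c / μ) • f = μ⁻¹ • S.baseChange ℂ := by
      rw [hS]; module
    rw [h1, LinearMap.range_smul _ _ (inv_ne_zero hμ0)]
    exact (finrank_range_baseChange_le S).trans hr
  obtain ⟨v, hv0, h1, h2, h3⟩ := t'.exists_invariant_of_finrank_range_h_le
    (by rwa [Module.finrank_baseChange]) hrange
  let ann : Submodule ℂ (Module.End ℂ (ℂ ⊗[ℝ] V)) := LinearMap.ker (LinearMap.applyₗ v)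
  obtain ⟨h4, h5, h6⟩ := hN ann h1 h2 h3
  exact hv0 (eq_zero_of_baseChange_eq_zero T hT fun i => hspan ann h4 h5 h6 i)

end Complexification

/-! ### The simple Lie algebras `sl(2, ℝ)` and `so(3)` -/

section Simple

variable {s : Type*} [LieRing s] [LieAlgebra ℝ s]

theorem exists_basis_of_equiv_sl (e : s ≃ₗ⁅ℝ⁆ LieAlgebra.SpecialLinear.sl (Fin 2) ℝ) :
    ∃ b : Module.Basis (Fin 3) ℝ s, IsSl2Triple (b 0) (b 1) (b 2) := by
  obtain ⟨c, hc⟩ : ∃ c : LieAlgebra.SpecialLinear.sl (Fin 2) ℝ ≃ₗ[ℝ] (Fin 3 → ℝ),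
      ∀ v, (c.symm v).1 = !![v 0, v 1; v 2, -v 0] := ⟨
    { toFun := fun A => ![A.1 0 0, A.1 0 1, A.1 1 0]
      invFun := fun v => ⟨!![v 0, v 1; v 2, -v 0], by
        change Matrix.trace (!![v 0, v 1; v 2, -v 0] : Matrix (Fin 2) (Fin 2) ℝ) = 0
        simp [Matrix.trace_fin_two]⟩
      map_add' := fun A B => by ext i; fin_cases i <;> simp
      map_smul' := fun a A => by ext i; fin_cases i <;> simp
      left_inv := fun A => by
        have hA : Matrix.trace A.1 = 0 := A.2
        rw [Matrix.trace_fin_two] at hA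
        ext i j
        fin_cases i <;> fin_cases j <;> simp
        linarith
      right_inv := fun v => by ext i; fin_cases i <;> simp }, fun v => rfl⟩
  let b : Module.Basis (Fin 3) ℝ s := Module.Basis.ofEquivFun (e.toLinearEquiv.trans c)
  have hb : ∀ i, e (b i) = c.symm (Pi.single i 1) := by
    intro i
    simp only [b, Module.Basis.coe_ofEquivFun]
    exact e.toLinearEquiv.apply_symm_apply _
  have hinj : Function.Injective e := e.injective
  refine ⟨b, b.ne_zero 0, ?_, ?_, ?_⟩
  · apply hinj
    rw [LieEquiv.map_lie, hb, hb, hb]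
    refine Subtype.ext ?_
    rw [LieSubalgebra.coe_bracket, hc, hc, hc, Ring.lie_def]
    ext i j; fin_cases i <;> fin_cases j <;> simp
  · apply hinj
    rw [LieEquiv.map_lie, map_nsmul, hb, hb]
    refine Subtype.ext ?_
    rw [LieSubalgebra.coe_bracket, two_smul, AddMemClass.coe_add, hc, hc, Ring.lie_def]
    ext i j; fin_cases i <;> fin_cases j <;> simp
  · apply hinj
    rw [LieEquiv.map_lie, map_neg, map_nsmul, hb, hb]
    refine Subtype.ext ?_
    rw [LieSubalgebra.coe_bracket, two_smul, NegMemClass.coe_neg, AddMemClass.coe_add, hc, hc,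
      Ring.lie_def]
    ext i j; fin_cases i <;> fin_cases j <;> simp
    norm_num

theorem exists_basis_of_equiv_so (e : s ≃ₗ⁅ℝ⁆ LieAlgebra.Orthogonal.so (Fin 3) ℝ) :
    ∃ b : Module.Basis (Fin 3) ℝ s, ⁅b 0, b 1⁆ = b 2 ∧ ⁅b 1, b 2⁆ = b 0 ∧ ⁅b 2, b 0⁆ = b 1 := by
  obtain ⟨c, hc⟩ : ∃ c : LieAlgebra.Orthogonal.so (Fin 3) ℝ ≃ₗ[ℝ] (Fin 3 → ℝ),
      ∀ v, (c.symm v).1 = !![0, -v 2, v 1; v 2, 0, -v 0; -v 1, v 0, 0] := ⟨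
    { toFun := fun A => ![A.1 2 1, A.1 0 2, A.1 1 0]
      invFun := fun v => ⟨!![0, -v 2, v 1; v 2, 0, -v 0; -v 1, v 0, 0], by
        rw [LieAlgebra.Orthogonal.mem_so]
        ext i j; fin_cases i <;> fin_cases j <;> simp⟩
      map_add' := fun A B => by ext i; fin_cases i <;> simp
      map_smul' := fun a A => by ext i; fin_cases i <;> simp
      left_inv := fun A => by
        have hA := (LieAlgebra.Orthogonal.mem_so _ _ _).1 A.2
        have hij : ∀ i j, A.1 i j = - A.1 j i := fun i j => congrFun (congrFun hA j) i
        ext i j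
        have h1 := hij i j
        have h2 := hij i i
        fin_cases i <;> fin_cases j <;> simp at * <;> linarith
      right_inv := fun v => by ext i; fin_cases i <;> simp }, fun v => rfl⟩
  let b : Module.Basis (Fin 3) ℝ s := Module.Basis.ofEquivFun (e.toLinearEquiv.trans c)
  have hb : ∀ i, e (b i) = c.symm (Pi.single i 1) := by
    intro i
    simp only [b, Module.Basis.coe_ofEquivFun]
    exact e.toLinearEquiv.apply_symm_apply _
  have hinj : Function.Injective e := e.injective
  refine ⟨b, ?_, ?_, ?_⟩ <;>
  · apply hinj
    rw [LieEquiv.map_lie, hb, hb, hb]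
    refine Subtype.ext ?_
    rw [LieSubalgebra.coe_bracket, hc, hc, hc, Ring.lie_def]
    ext i j; fin_cases i <;> fin_cases j <;> simp

theorem finrank_eq_three (hs : Nonempty (s ≃ₗ⁅ℝ⁆ LieAlgebra.SpecialLinear.sl (Fin 2) ℝ) ∨
    Nonempty (s ≃ₗ⁅ℝ⁆ LieAlgebra.Orthogonal.so (Fin 3) ℝ)) : Module.finrank ℝ s = 3 := by
  rcases hs with ⟨⟨e⟩⟩ | ⟨⟨e⟩⟩
  · obtain ⟨b, -⟩ := exists_basis_of_equiv_sl e
    simpa using Module.finrank_eq_card_basis b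
  · obtain ⟨b, -⟩ := exists_basis_of_equiv_so e
    simpa using Module.finrank_eq_card_basis b

/-- `s` is perfect: a linear form that vanishes on all brackets is zero. -/
theorem eq_zero_of_map_lie_eq_zero (hs : Nonempty (s ≃ₗ⁅ℝ⁆ LieAlgebra.SpecialLinear.sl (Fin 2) ℝ) ∨
    Nonempty (s ≃ₗ⁅ℝ⁆ LieAlgebra.Orthogonal.so (Fin 3) ℝ)) (φ : s →ₗ[ℝ] ℝ)
    (hφ : ∀ x y : s, φ ⁅x, y⁆ = 0) : φ = 0 := by
  rcases hs with ⟨⟨e⟩⟩ | ⟨⟨e⟩⟩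
  · obtain ⟨b, t⟩ := exists_basis_of_equiv_sl e
    refine b.ext fun i => ?_
    fin_cases i
    · simpa [t.lie_e_f] using hφ (b 1) (b 2)
    · simpa [t.lie_h_e_smul ℝ] using hφ (b 0) (b 1)
    · simpa [t.lie_lie_smul_f ℝ] using hφ (b 0) (b 2)
  · obtain ⟨b, h1, h2, h3⟩ := exists_basis_of_equiv_so e
    refine b.ext fun i => ?_
    fin_cases i
    · simpa [h2] using hφ (b 1) (b 2)
    · simpa [h3] using hφ (b 2) (b 0)
    · simpa [h1] using hφ (b 0) (b 1)

variable {V : Type*} [AddCommGroup V] [Module ℝ V]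

theorem eq_zero_of_forall_apply_eq_zero (ρ : s →ₗ⁅ℝ⁆ Module.End ℝ V)
    (hirr : ∀ N : Submodule ℝ V, (∀ x, ∀ v ∈ N, ρ x v ∈ N) → N = ⊥ ∨ N = ⊤)
    (hV : 2 ≤ Module.finrank ℝ V) {v : V} (hv : ∀ x, ρ x v = 0) : v = 0 := by
  rcases hirr (Submodule.span ℝ {v}) (fun x w hw => by
    obtain ⟨c, rfl⟩ := Submodule.mem_span_singleton.1 hw
    simp [hv]) with h | h
  · simpa using h
  · have := finrank_span_le_card (R := ℝ) ({v} : Set V)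
    rw [h, finrank_top] at this
    simp at this
    omega

theorem lt_finrank_range_of_equiv_sl [FiniteDimensional ℝ V]
    (e : s ≃ₗ⁅ℝ⁆ LieAlgebra.SpecialLinear.sl (Fin 2) ℝ)
    (ρ : s →ₗ⁅ℝ⁆ Module.End ℝ V)
    (hirr : ∀ N : Submodule ℝ V, (∀ x, ∀ v ∈ N, ρ x v ∈ N) → N = ⊥ ∨ N = ⊤)
    (hV : 4 ≤ Module.finrank ℝ V) {x : s} (hx : x ≠ 0) :
    2 < Module.finrank ℝ (LinearMap.range (ρ x)) := by
  obtain ⟨b, t⟩ := exists_basis_of_equiv_sl e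
  have hx' : x = b.repr x 0 • b 0 + b.repr x 1 • b 1 + b.repr x 2 • b 2 := by
    conv_lhs => rw [← b.sum_repr x, Fin.sum_univ_three]
  have hN : ∀ N : Submodule ℝ s, b 0 ∈ N → b 1 ∈ N → b 2 ∈ N → ∀ y, y ∈ N := by
    intro N h0 h1 h2 y
    rw [← b.sum_repr y, Fin.sum_univ_three]
    exact N.add_mem (N.add_mem (N.smul_mem _ h0) (N.smul_mem _ h1)) (N.smul_mem _ h2)
  have hinv : ∀ v, (∀ y, ρ y v = 0) → v = 0 := fun v hv =>
    eq_zero_of_forall_apply_eq_zero ρ hirr (by omega) hv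
  -- the image of a triple that generates `s` is a triple
  have hmap : ∀ {h' e' f' : s}, IsSl2Triple h' e' f' →
      (∀ N : Submodule ℝ s, h' ∈ N → e' ∈ N → f' ∈ N → ∀ y, y ∈ N) →
      IsSl2Triple (ρ h') (ρ e') (ρ f') := by
    intro h' e' f' t' hN'
    refine ⟨fun h0 => ?_, by rw [← LieHom.map_lie, t'.lie_e_f],
      by rw [← LieHom.map_lie, t'.lie_h_e_nsmul, map_nsmul],
      by rw [← LieHom.map_lie, t'.lie_h_f_nsmul, map_neg, map_nsmul]⟩
    have he : ρ e' = 0 := by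
      have := congrArg ρ (t'.lie_h_e_smul ℝ)
      rw [LieHom.map_lie, h0, zero_lie, map_smul] at this
      simpa using this.symm
    have hf : ρ f' = 0 := by
      have := congrArg ρ (t'.lie_lie_smul_f ℝ)
      rw [LieHom.map_lie, h0, zero_lie, map_neg, map_smul] at this
      simpa using this.symm
    have hall := hN' (LinearMap.ker (ρ : s →ₗ[ℝ] Module.End ℝ V)) h0 he hf
    have : Nontrivial V := Module.nontrivial_of_finrank_pos (R := ℝ) (by omega)
    obtain ⟨v, hv⟩ := exists_ne (0 : V)
    refine hv (hinv v fun y => ?_)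
    have hy : ρ y = 0 := hall y
    rw [hy, LinearMap.zero_apply]
  -- the determinant of `x`, up to sign
  by_cases hq : (b.repr x 0) ^ 2 + b.repr x 1 * b.repr x 2 = 0
  · obtain ⟨h', f', t', hN'⟩ := t.exists_triple_of_sq_eq_zero hq (by rwa [← hx'])
    rw [← hx'] at t' hN'
    have hgen : ∀ N : Submodule ℝ s, h' ∈ N → x ∈ N → f' ∈ N → ∀ y, y ∈ N := by
      intro N h1 h2 h3
      obtain ⟨h4, h5, h6⟩ := hN' N h1 h2 h3
      exact hN N h4 h5 h6
    refine (hmap t' hgen).lt_finrank_range_e hV fun N hNs => hirr N fun y v hv => ?_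
    let stab : Submodule ℝ s :=
      ⨅ v ∈ N, N.comap ((LinearMap.applyₗ v).comp (ρ : s →ₗ[ℝ] Module.End ℝ V))
    have hst : ∀ y, y ∈ stab ↔ ∀ v ∈ N, ρ y v ∈ N := by
      intro y
      simp [stab]
    exact (hst y).1 (hgen stab ((hst _).2 fun v hv => (hNs v hv).1)
      ((hst _).2 fun v hv => (hNs v hv).2.1) ((hst _).2 fun v hv => (hNs v hv).2.2) y) v hv
  · have t1 := hmap t hN
    let β : Module.End ℝ V →ₐ[ℝ] Module.End ℂ (ℂ ⊗[ℝ] V) := Module.End.baseChangeHom ℝ ℂ V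
    have hreal : ∀ (a : ℝ) (T : Module.End ℂ (ℂ ⊗[ℝ] V)), a • T = (a : ℂ) • T :=
      fun a T => (algebraMap_smul ℂ a T).symm
    have hβ : ∀ T, β T = T.baseChange ℂ := fun T => rfl
    have hβlie : ∀ S T, β ⁅S, T⁆ = ⁅β S, β T⁆ := fun S T => by
      rw [Ring.lie_def, Ring.lie_def, map_sub, map_mul, map_mul]
    have hT : ∀ v, (∀ i : Fin 3, ρ (b i) v = 0) → v = 0 := by
      intro v hv
      refine hinv v fun y => ?_
      exact hN (LinearMap.ker ((LinearMap.applyₗ v).comp (ρ : s →ₗ[ℝ] Module.End ℝ V)))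
        (hv 0) (hv 1) (hv 2) y
    have t2 : IsSl2Triple (β (ρ (b 0))) (β (ρ (b 1))) (β (ρ (b 2))) := by
      refine ⟨fun h0 => ?_, by rw [← hβlie, t1.lie_e_f],
        by rw [← hβlie, t1.lie_h_e_nsmul, map_nsmul],
        by rw [← hβlie, t1.lie_h_f_nsmul, map_neg, map_nsmul]⟩
      refine t1.h_ne_zero ?_
      ext v
      have h1 : (1 : ℂ) ⊗ₜ[ℝ] (ρ (b 0) v) = 0 := by
        have := congrArg (fun S => S ((1 : ℂ) ⊗ₜ[ℝ] v)) h0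
        simpa [hβ] using this
      have hinj := Module.Flat.rTensor_preserves_injective_linearMap (M := V)
        (Algebra.linearMap ℝ ℂ) (algebraMap ℝ ℂ).injective
      have h2 : (LinearMap.rTensor V (Algebra.linearMap ℝ ℂ)) ((1 : ℝ) ⊗ₜ[ℝ] (ρ (b 0) v)) = 0 := by
        simpa using h1
      have h3 := hinj (h2.trans (map_zero _).symm)
      simpa using congrArg (TensorProduct.lid ℝ V) h3
    refine lt_finrank_range_of_baseChange_mem_sl2 t2 hV (fun i => ρ (b i)) hT
      (fun N h0 h1 h2 i => ?_) (a := (b.repr x 0 : ℂ)) (b := (b.repr x 1 : ℂ))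
      (c := (b.repr x 2 : ℂ)) (by exact_mod_cast hq) ?_
    · fin_cases i
      exacts [h0, h1, h2]
    · conv_lhs => rw [hx']
      rw [← hβ]
      simp only [map_add, map_smul, hreal]

/-- The `sl₂`-triple in the complexification of `so(3)`. -/
theorem isSl2Triple_of_cyclic {L : Type*} [LieRing L] [LieAlgebra ℂ L] {A B C : L}
    (hAB : ⁅A, B⁆ = C) (hBC : ⁅B, C⁆ = A) (hCA : ⁅C, A⁆ = B) (hC : C ≠ 0) :
    IsSl2Triple ((2 * Complex.I) • C) (A + Complex.I • B) (-A + Complex.I • B) := by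
  have hBA : ⁅B, A⁆ = -C := by rw [← lie_skew, hAB]
  have hCB : ⁅C, B⁆ = -A := by rw [← lie_skew, hBC]
  have hII : Complex.I * Complex.I = -1 := Complex.I_mul_I
  refine ⟨smul_ne_zero (by simp) hC, ?_, ?_, ?_⟩
  · simp only [add_lie, lie_add, smul_lie, lie_smul, lie_neg, lie_self, hAB, hBA]
    module
  · rw [← Nat.cast_smul_eq_nsmul ℂ]
    simp only [lie_add, smul_lie, lie_smul, hCA, hCB]
    match_scalars <;> first | ring1 | linear_combination -2 * hII
  · rw [← Nat.cast_smul_eq_nsmul ℂ]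
    simp only [lie_add, smul_lie, lie_smul, lie_neg, hCA, hCB]
    match_scalars <;> first | ring1 | linear_combination -2 * hII

/-- Every nonzero element of `so(3)` is semisimple, as the determinant of its image in `sl(2, ℂ)` is a
quarter of the sum of the squares of its coordinates. -/
theorem lt_finrank_range_of_equiv_so [FiniteDimensional ℝ V]
    (e : s ≃ₗ⁅ℝ⁆ LieAlgebra.Orthogonal.so (Fin 3) ℝ)
    (ρ : s →ₗ⁅ℝ⁆ Module.End ℝ V)
    (hirr : ∀ N : Submodule ℝ V, (∀ x, ∀ v ∈ N, ρ x v ∈ N) → N = ⊥ ∨ N = ⊤)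
    (hV : 4 ≤ Module.finrank ℝ V) {x : s} (hx : x ≠ 0) :
    2 < Module.finrank ℝ (LinearMap.range (ρ x)) := by
  obtain ⟨b, h01, h12, h20⟩ := exists_basis_of_equiv_so e
  have hx' : x = b.repr x 0 • b 0 + b.repr x 1 • b 1 + b.repr x 2 • b 2 := by
    conv_lhs => rw [← b.sum_repr x, Fin.sum_univ_three]
  have hinv : ∀ v, (∀ i : Fin 3, ρ (b i) v = 0) → v = 0 := by
    intro v hv
    refine eq_zero_of_forall_apply_eq_zero ρ hirr (by omega) fun y => ?_
    rw [← b.sum_repr y, Fin.sum_univ_three]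
    simp [hv]
  let β : Module.End ℝ V →ₐ[ℝ] Module.End ℂ (ℂ ⊗[ℝ] V) := Module.End.baseChangeHom ℝ ℂ V
  have hreal : ∀ (a : ℝ) (T : Module.End ℂ (ℂ ⊗[ℝ] V)), a • T = (a : ℂ) • T :=
    fun a T => (algebraMap_smul ℂ a T).symm
  have hβ : ∀ T, β T = T.baseChange ℂ := fun T => rfl
  have hβlie : ∀ y z, β (ρ ⁅y, z⁆) = ⁅β (ρ y), β (ρ z)⁆ := fun S T => by
    rw [LieHom.map_lie, Ring.lie_def, Ring.lie_def, map_sub, map_mul, map_mul]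
  set A := β (ρ (b 0)) with hA
  set B := β (ρ (b 1)) with hB
  set C := β (ρ (b 2)) with hC
  have hAB : ⁅A, B⁆ = C := by rw [hA, hB, ← hβlie, h01]
  have hBC : ⁅B, C⁆ = A := by rw [hB, hC, ← hβlie, h12]
  have hCA : ⁅C, A⁆ = B := by rw [hC, hA, ← hβlie, h20]
  have hII : Complex.I * Complex.I = -1 := Complex.I_mul_I
  have hne : C ≠ 0 := by
    intro h0
    have hA0 : A = 0 := by rw [← hBC, h0, lie_zero]
    have hB0 : B = 0 := by rw [← hCA, h0, zero_lie]
    have : Nontrivial (ℂ ⊗[ℝ] V) := Module.nontrivial_of_finrank_pos (R := ℂ)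
      (by rw [Module.finrank_baseChange]; omega)
    obtain ⟨v, hv⟩ := exists_ne (0 : ℂ ⊗[ℝ] V)
    refine hv (eq_zero_of_baseChange_eq_zero (fun i => ρ (b i)) hinv fun i => ?_)
    rw [← hβ]
    fin_cases i
    · exact congrArg (fun S => S v) hA0
    · exact congrArg (fun S => S v) hB0
    · exact congrArg (fun S => S v) h0
  have t : IsSl2Triple ((2 * Complex.I) • C) (A + Complex.I • B) (-A + Complex.I • B) := 
    isSl2Triple_of_cyclic hAB hBC hCA hne
  have hspan : ∀ N : Submodule ℂ (Module.End ℂ (ℂ ⊗[ℝ] V)), (2 * Complex.I) • C ∈ N →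
      A + Complex.I • B ∈ N → -A + Complex.I • B ∈ N → A ∈ N ∧ B ∈ N ∧ C ∈ N := by
    intro N h1 h2 h3
    refine ⟨?_, ?_, ?_⟩
    · convert! N.smul_mem (1 / 2) (N.sub_mem h2 h3) using 1
      module
    · convert! N.smul_mem (-Complex.I / 2) (N.add_mem h2 h3) using 1
      match_scalars
      · linear_combination hII
      · ring
    · convert! N.smul_mem (-Complex.I / 2) h1 using 1
      match_scalars
      linear_combination hII
  have hsq : (b.repr x 0) ^ 2 + (b.repr x 1) ^ 2 + (b.repr x 2) ^ 2 ≠ 0 := by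
    intro h0
    have h1 : b.repr x 0 = 0 := by nlinarith [sq_nonneg (b.repr x 1), sq_nonneg (b.repr x 2)]
    have h2 : b.repr x 1 = 0 := by nlinarith [sq_nonneg (b.repr x 0), sq_nonneg (b.repr x 2)]
    have h3 : b.repr x 2 = 0 := by nlinarith [sq_nonneg (b.repr x 0), sq_nonneg (b.repr x 1)]
    rw [h1, h2, h3] at hx'
    simp at hx'
    exact hx hx'
  refine lt_finrank_range_of_baseChange_mem_sl2 t hV (fun i => ρ (b i)) hinv
    (fun N h0 h1 h2 i => ?_) (a := -Complex.I / 2 * (b.repr x 2 : ℂ))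
    (b := ((b.repr x 0 : ℂ) - Complex.I * (b.repr x 1 : ℂ)) / 2)
    (c := (-(b.repr x 0 : ℂ) - Complex.I * (b.repr x 1 : ℂ)) / 2) ?_ ?_
  · obtain ⟨h4, h5, h6⟩ := hspan N h0 h1 h2
    fin_cases i
    exacts [h4, h5, h6]
  · have h1 : ((b.repr x 0) ^ 2 + (b.repr x 1) ^ 2 + (b.repr x 2) ^ 2 : ℂ) ≠ 0 := by
      exact_mod_cast hsq
    contrapose! h1
    linear_combination (-4) * h1 + ((b.repr x 1 : ℂ) ^ 2 + (b.repr x 2 : ℂ) ^ 2) * hII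
  · conv_lhs => rw [hx']
    rw [← hβ]
    simp only [map_add, map_smul, hreal, ← hA, ← hB, ← hC]
    match_scalars
    · ring
    · linear_combination (b.repr x 1 : ℂ) * hII
    · linear_combination (b.repr x 2 : ℂ) * hII

theorem lt_finrank_range [FiniteDimensional ℝ V]
    (hs : Nonempty (s ≃ₗ⁅ℝ⁆ LieAlgebra.SpecialLinear.sl (Fin 2) ℝ) ∨
      Nonempty (s ≃ₗ⁅ℝ⁆ LieAlgebra.Orthogonal.so (Fin 3) ℝ))
    (ρ : s →ₗ⁅ℝ⁆ Module.End ℝ V)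
    (hirr : ∀ N : Submodule ℝ V, (∀ x, ∀ v ∈ N, ρ x v ∈ N) → N = ⊥ ∨ N = ⊤)
    (hV : 4 ≤ Module.finrank ℝ V) {x : s} (hx : x ≠ 0) :
    2 < Module.finrank ℝ (LinearMap.range (ρ x)) := by
  rcases hs with ⟨⟨e⟩⟩ | ⟨⟨e⟩⟩
  · exact lt_finrank_range_of_equiv_sl e ρ hirr hV hx
  · exact lt_finrank_range_of_equiv_so e ρ hirr hV hx

end Simple

/-! ### Degeneracy of the coadjoint forms of the semidirect sum -/

section Algebra

/-- An alternating form on a space of odd dimension is degenerate. -/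
theorem exists_ne_zero_of_odd_finrank {V : Type*} [AddCommGroup V] [Module ℝ V]
    [FiniteDimensional ℝ V] (hV : Odd (Module.finrank ℝ V)) (B : V →ₗ[ℝ] V →ₗ[ℝ] ℝ)
    (hB : ∀ x y, B x y = -B y x) : ∃ x ≠ 0, ∀ y, B x y = 0 := by
  let b := Module.finBasis ℝ V
  let M : Matrix (Fin (Module.finrank ℝ V)) (Fin (Module.finrank ℝ V)) ℝ :=
    Matrix.of fun i j => B (b j) (b i)
  have hM : M.transpose = -M := by
    ext i j
    simpa [M] using hB _ _
  have hdet : M.det = 0 := by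
    have h := congrArg Matrix.det hM
    rw [Matrix.det_transpose, Matrix.det_neg, Fintype.card_fin, hV.neg_one_pow] at h
    linarith
  obtain ⟨v, hv, hMv⟩ := Matrix.exists_mulVec_eq_zero_iff.2 hdet
  refine ⟨∑ i, v i • b i, fun h0 => hv ?_, fun y => ?_⟩
  · funext i
    exact Fintype.linearIndependent_iff.1 b.linearIndependent v h0 i
  · have : B (∑ i, v i • b i) = 0 := b.ext fun i => by
      have := congrFun hMv i
      simpa [Matrix.mulVec, dotProduct, M, mul_comm] using this
    simp [this]

variable {s r : Type*} [LieRing s] [LieAlgebra ℝ s] [LieRing r] [LieAlgebra ℝ r]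

theorem IsIrreducibleRep.lie_eq_zero {R : s →ₗ⁅ℝ⁆ LieDerivation ℝ r r} (hR : IsIrreducibleRep R)
    [LieAlgebra.IsSolvable r] (x y : r) : ⁅x, y⁆ = 0 := by
  have := hR.1
  let D : Submodule ℝ r := Submodule.span ℝ {z | ∃ x y : r, ⁅x, y⁆ = z}
  have hD : LieSubmodule.toSubmodule (LieAlgebra.derivedSeries ℝ r 1) = D := by
    rw [LieAlgebra.derivedSeries_def, LieAlgebra.derivedSeriesOfIdeal_succ,
      LieAlgebra.derivedSeriesOfIdeal_zero, LieSubmodule.lieIdeal_oper_eq_linear_span']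
    simp [D]
  have hlt := LieAlgebra.derivedSeries_lt_top_of_solvable (R := ℝ) (L := r)
  rcases hR.2 D (fun a w hw => by
    induction hw using Submodule.span_induction with
    | mem w hw =>
      obtain ⟨u, v, rfl⟩ := hw
      rw [LieDerivation.apply_lie_eq_add]
      exact D.add_mem (Submodule.subset_span ⟨_, _, rfl⟩) (Submodule.subset_span ⟨_, _, rfl⟩)
    | zero => simp
    | add u v _ _ hu hv => rw [map_add]; exact D.add_mem hu hv
    | smul c u _ hu => rw [map_smul]; exact D.smul_mem c hu) with h | h
  · have : ⁅x, y⁆ ∈ D := Submodule.subset_span ⟨x, y, rfl⟩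
    rw [h] at this
    simpa using this
  · rw [h] at hD
    exact absurd ((LieSubmodule.toSubmodule_eq_top _).1 hD) hlt.ne

/-- The representation underlying an action by derivations. -/
def repHom (R : s →ₗ⁅ℝ⁆ LieDerivation ℝ r r) : s →ₗ⁅ℝ⁆ Module.End ℝ r :=
  (LieDerivation.toLinearMapLieHom ℝ r).comp R

@[simp]
theorem repHom_apply (R : s →ₗ⁅ℝ⁆ LieDerivation ℝ r r) (x : s) (y : r) : repHom R x y = R x y := rfl

theorem trace_eq_zero_of_perfect
    (hs : ∀ φ : s →ₗ[ℝ] ℝ, (∀ x y : s, φ ⁅x, y⁆ = 0) → φ = 0)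
    {V : Type*} [AddCommGroup V] [Module ℝ V]
    (ρ : s →ₗ⁅ℝ⁆ Module.End ℝ V) (x : s) : LinearMap.trace ℝ V (ρ x) = 0 := by
  have := hs ((LinearMap.trace ℝ V).comp (ρ : s →ₗ[ℝ] Module.End ℝ V)) fun x y => by
    simp
  exact congrArg (fun φ => φ x) this

/-- A linear representation of a perfect Lie algebra has no open orbit with discrete
stabilizers. -/
theorem not_bijective_of_perfect [FiniteDimensional ℝ s]
    (hs : ∀ φ : s →ₗ[ℝ] ℝ, (∀ x y : s, φ ⁅x, y⁆ = 0) → φ = 0)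
    {V : Type*} [AddCommGroup V] [Module ℝ V]
    [FiniteDimensional ℝ V] [Nontrivial V] (ρ : s →ₗ⁅ℝ⁆ Module.End ℝ V) (ξ : Module.Dual ℝ V)
    (A : V ≃ₗ[ℝ] Module.Dual ℝ s) : ∃ x y, A y x ≠ ξ (ρ x y) := by
  by_contra! hA
  -- an element `e` of `s` that fixes `ξ`
  obtain ⟨e, he⟩ : ∃ e : s, ∀ y, ξ (ρ e y) = ξ y := by
    obtain ⟨e, he⟩ := (Module.evalEquiv ℝ s).surjective (ξ.comp A.symm.toLinearMap)
    refine ⟨e, fun y => ?_⟩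
    have := congrArg (fun φ => φ (A y)) he
    simpa [hA] using this
  have hconj : A.conj (ρ e) + Module.Dual.transpose (LieAlgebra.ad ℝ s e) = LinearMap.id := by
    refine LinearMap.ext fun φ => ?_
    obtain ⟨y, rfl⟩ := A.surjective φ
    refine LinearMap.ext fun x => ?_
    have h1 : ρ x (ρ e y) = ρ e (ρ x y) - ρ ⁅e, x⁆ y := by
      rw [LieHom.map_lie, Ring.lie_def]
      simp
    have h2 : A (ρ e y) x + A y ⁅e, x⁆ = A y x := by
      rw [hA, h1, map_sub, he, hA, hA, sub_add_cancel]
    rw [LinearMap.add_apply, LinearEquiv.conj_apply_apply, A.symm_apply_apply]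
    exact h2
  have h1 : LinearMap.trace ℝ V (ρ e) +
      LinearMap.trace ℝ _ (Module.Dual.transpose (R := ℝ) (LieAlgebra.ad ℝ s e)) =
        LinearMap.trace ℝ (Module.Dual ℝ s) LinearMap.id := by
    rw [← LinearMap.trace_conj' (ρ e) A, ← map_add, hconj]
  rw [LinearMap.trace_transpose', LinearMap.trace_id,
    trace_eq_zero_of_perfect hs, trace_eq_zero_of_perfect hs (LieAlgebra.ad ℝ s), add_zero,
    ← A.finrank_eq, eq_comm, Nat.cast_eq_zero] at h1
  have := Module.finrank_pos (R := ℝ) (M := V)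
  omega

/-- The Poisson tensor of the semidirect sum is degenerate at every point `z` of the dual space. -/
theorem exists_lie_eq_zero [FiniteDimensional ℝ s] [FiniteDimensional ℝ r] [Nontrivial r]
    (hs : ∀ φ : s →ₗ[ℝ] ℝ, (∀ x y : s, φ ⁅x, y⁆ = 0) → φ = 0)
    (h3 : Module.finrank ℝ s = 3) (hr : ∀ x y : r, ⁅x, y⁆ = 0)
    (R : s →ₗ⁅ℝ⁆ LieDerivation ℝ r r) (z : Module.Dual ℝ (LieAlgebra.SemiDirectSum r s R)) :
    ∃ X : LieAlgebra.SemiDirectSum r s R, X ≠ 0 ∧ ∀ Y, z ⁅X, Y⁆ = 0 := by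
  let ξ : Module.Dual ℝ r := z.comp (LieAlgebra.SemiDirectSum.inl R : r →ₗ[ℝ] _)
  let A : r →ₗ[ℝ] Module.Dual ℝ s :=
    ((LinearMap.compRight ℝ ξ).comp (repHom R : s →ₗ[ℝ] Module.End ℝ r)).flip
  have hA : ∀ y x, A y x = ξ (R x y) := fun y x => rfl
  by_cases hker : ∃ y ≠ 0, A y = 0
  · obtain ⟨y, hy, hAy⟩ := hker
    refine ⟨⟨y, 0⟩, fun h => hy (congrArg LieAlgebra.SemiDirectSum.left h), fun Y => ?_⟩
    have h1 : ⁅(⟨y, 0⟩ : LieAlgebra.SemiDirectSum r s R), Y⁆ =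
        -LieAlgebra.SemiDirectSum.inl R (R Y.right y) := by
      simp [hr]
    have h2 : z (LieAlgebra.SemiDirectSum.inl R (R Y.right y)) = A y Y.right := rfl
    rw [h1, map_neg, h2, hAy]
    simp
  · have hinj : Function.Injective A := by
      rw [← LinearMap.ker_eq_bot, LinearMap.ker_eq_bot']
      intro y hy
      by_contra h
      exact hker ⟨y, h, hy⟩
    have hle := LinearMap.finrank_le_finrank_of_injective hinj
    rw [Subspace.dual_finrank_eq, h3] at hle
    have hpos := Module.finrank_pos (R := ℝ) (M := r)
    obtain h | h | h : Module.finrank ℝ r = 1 ∨ Module.finrank ℝ r = 2 ∨ Module.finrank ℝ r = 3 := by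
      omega
    · exfalso
      obtain ⟨y, hy⟩ := exists_ne (0 : r)
      refine hker ⟨y, hy, LinearMap.ext fun x => ?_⟩
      obtain ⟨c, hc, -⟩ := (repHom R x : r →ₗ[ℝ] r).existsUnique_eq_smul_id_of_finrank_eq_one h
      have h1 := trace_eq_zero_of_perfect hs (repHom R) x
      rw [hc, map_smul, LinearMap.trace_id, h] at h1
      have h2 : c = 0 := by simpa using h1
      rw [h2, zero_smul] at hc
      have h3 : R x y = 0 := congrArg (fun T => T y) hc
      rw [hA, h3, map_zero]; rfl
    · let e := LieAlgebra.SemiDirectSum.toProdl R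
      have : FiniteDimensional ℝ (LieAlgebra.SemiDirectSum r s R) :=
        e.symm.finiteDimensional
      refine exists_ne_zero_of_odd_finrank (by rw [e.finrank_eq, Module.finrank_prod, h, h3]; decide)
        ((LinearMap.compRight ℝ z).comp
          (LieAlgebra.ad ℝ (LieAlgebra.SemiDirectSum r s R) : _ →ₗ[ℝ] _)) fun X Y => ?_
      change z ⁅X, Y⁆ = - z ⁅Y, X⁆
      rw [← lie_skew, map_neg]
    · exfalso
      obtain ⟨x, y, hxy⟩ := not_bijective_of_perfect hs (repHom R) ξ
        (LinearEquiv.ofInjectiveOfFinrankEq A hinj (by rw [Subspace.dual_finrank_eq, h, h3]))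
      exact hxy (hA y x)

end Algebra

/-! ### Dual representations and coadjoint vector fields in coordinates -/

section Transpose

variable {ι : Type*} [Fintype ι] {V : Type*} [AddCommGroup V] [Module ℝ V]

/-- The transpose of an endomorphism of `V`, acting on the coordinates of the dual space of `V`. The
functional with coordinates `x` is `b.constr ℝ x`. -/
noncomputable def transposeOn (b : Module.Basis ι ℝ V) :
    Module.End ℝ V →ₗ[ℝ] ((ι → ℝ) →L[ℝ] (ι → ℝ)) :=
  LinearMap.toContinuousLinearMap.toLinearMap.comp
    ((b.constr ℝ).symm.conj.toLinearMap.comp Module.Dual.transpose)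

theorem constr_transposeOn (b : Module.Basis ι ℝ V) (T : Module.End ℝ V) (x : ι → ℝ) (v : V) :
    b.constr ℝ (transposeOn b T x) v = b.constr ℝ x (T v) := by
  have h : transposeOn b T x = (b.constr ℝ).symm ((b.constr ℝ x).comp T) := rfl
  rw [h, LinearEquiv.apply_symm_apply, LinearMap.comp_apply]

theorem transposeOn_apply (b : Module.Basis ι ℝ V) (T : Module.End ℝ V) (x : ι → ℝ) (j : ι) :
    transposeOn b T x j = b.constr ℝ x (T (b j)) := by
  rw [← constr_transposeOn, b.constr_basis]

theorem transposeOn_lie (b : Module.Basis ι ℝ V) (S T : Module.End ℝ V) :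
    transposeOn b S * transposeOn b T - transposeOn b T * transposeOn b S =
      transposeOn b ⁅T, S⁆ := by
  ext x j
  simp only [Ring.lie_def, map_sub, sub_apply, mul_apply_eq_comp, Pi.sub_apply,
    transposeOn_apply, constr_transposeOn, Module.End.mul_apply]

theorem finrank_range_transposeOn (b : Module.Basis ι ℝ V) (T : Module.End ℝ V) :
    Module.finrank ℝ (LinearMap.range (transposeOn b T : (ι → ℝ) →ₗ[ℝ] (ι → ℝ))) =
      Module.finrank ℝ (LinearMap.range T) := by
  have : FiniteDimensional ℝ V := b.finiteDimensional_of_finite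
  have h : (transposeOn b T : (ι → ℝ) →ₗ[ℝ] (ι → ℝ)) =
      (b.constr ℝ).symm.toLinearMap.comp
        ((T.dualMap).comp (b.constr ℝ : (ι → ℝ) ≃ₗ[ℝ] Module.Dual ℝ V).toLinearMap) := rfl
  rw [h, LinearMap.range_comp, LinearEquiv.finrank_map_eq,
    LinearMap.range_comp_of_range_eq_top _ (LinearEquiv.range _),
    LinearMap.finrank_range_dualMap_eq_finrank_range]

variable {s : Type*} [LieRing s] [LieAlgebra ℝ s]

/-- The linear Lie algebra of the representation dual to `ρ`, in the coordinates of the dual space. -/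
noncomputable def dualAction (b : Module.Basis ι ℝ V) (ρ : s →ₗ⁅ℝ⁆ Module.End ℝ V) :
    Submodule ℝ ((ι → ℝ) →L[ℝ] (ι → ℝ)) :=
  LinearMap.range ((transposeOn b).comp (ρ : s →ₗ[ℝ] Module.End ℝ V))

theorem mem_dualAction {b : Module.Basis ι ℝ V} {ρ : s →ₗ⁅ℝ⁆ Module.End ℝ V}
    {A : (ι → ℝ) →L[ℝ] (ι → ℝ)} : A ∈ dualAction b ρ ↔ ∃ x, transposeOn b (ρ x) = A := Iff.rfl

theorem commutator_mem_dualAction (b : Module.Basis ι ℝ V) (ρ : s →ₗ⁅ℝ⁆ Module.End ℝ V) :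
    ∀ A ∈ dualAction b ρ, ∀ B ∈ dualAction b ρ, A * B - B * A ∈ dualAction b ρ := by
  rintro _ ⟨x, rfl⟩ _ ⟨y, rfl⟩
  refine mem_dualAction.2 ⟨⁅y, x⁆, ?_⟩
  rw [LieHom.map_lie, ← transposeOn_lie]
  rfl

/-- The differential `x ↦ ρ(x)ᵀ w` at the identity of the orbit map of the point `w` of the dual
space. -/
noncomputable def orbitMap (b : Module.Basis ι ℝ V) (ρ : s →ₗ⁅ℝ⁆ Module.End ℝ V) (w : ι → ℝ) :
    s →ₗ[ℝ] (ι → ℝ) :=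
  ((ContinuousLinearMap.apply ℝ (ι → ℝ) w : _ →L[ℝ] (ι → ℝ)) :
    ((ι → ℝ) →L[ℝ] (ι → ℝ)) →ₗ[ℝ] (ι → ℝ)).comp
    ((transposeOn b).comp (ρ : s →ₗ[ℝ] Module.End ℝ V))

theorem orbitTangent_dualAction (b : Module.Basis ι ℝ V) (ρ : s →ₗ⁅ℝ⁆ Module.End ℝ V)
    (w : ι → ℝ) : orbitTangent (dualAction b ρ) w = LinearMap.range (orbitMap b ρ w) := by
  rw [orbitMap, LinearMap.range_comp]; rfl

end Transpose

/-! ### Non-trivial invariants of a Lie algebra with degenerate coadjoint forms -/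

section Coordinates

variable {ι : Type*} [Fintype ι]

theorem linearIndependent_of_surjective {W : Type*} [NormedAddCommGroup W] [NormedSpace ℝ W]
    {k : ℕ} {f : W →L[ℝ] (Fin k → ℝ)} (hf : Function.Surjective f) :
    LinearIndependent ℝ fun a => (ContinuousLinearMap.proj a).comp f := by
  rw [Fintype.linearIndependent_iff]
  intro c hc a
  obtain ⟨v, hv⟩ := hf (Pi.single a 1)
  have := congrArg (fun g => g v) hc
  simpa [hv, Pi.single_apply] using this

theorem fderiv_apply_eq_sum_partialDeriv [DecidableEq ι] (F : (ι → ℝ) → ℝ) (x v : ι → ℝ) :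
    fderiv ℝ F x v = ∑ j, v j * partialDeriv F j x := by
  conv_lhs => rw [pi_eq_sum_univ' v]
  simp only [map_sum, map_smul, smul_eq_mul, partialDeriv]

variable [DecidableEq ι] {g : Type*} [LieRing g] [LieAlgebra ℝ g]

/-- The fields `X̂_i` are the vector fields of the coadjoint action. -/
theorem coadjointField_eq (b : Module.Basis ι ℝ g) (i : ι) (F : (ι → ℝ) → ℝ) (x : ι → ℝ) :
    coadjointField b i F x =
      -fderiv ℝ F x (transposeOn b (LieAlgebra.ad ℝ g (b i)) x) := by
  rw [fderiv_apply_eq_sum_partialDeriv, coadjointField]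
  simp only [transposeOn_apply, LieAlgebra.ad_apply, b.constr_apply_fintype ℝ, structureConstant,
    Finset.sum_neg_distrib, Finset.sum_mul, Module.Basis.equivFun_apply, smul_eq_mul]

theorem IsInvariantSubmersionAt.congr {W : Type*} [NormedAddCommGroup W] [NormedSpace ℝ W] {k : ℕ}
    {L : Submodule ℝ (W →L[ℝ] W)} {F G : W → Fin k → ℝ} {x : W} (h : F =ᶠ[𝓝 x] G)
    (hF : IsInvariantSubmersionAt L F x) : IsInvariantSubmersionAt L G x where
  smooth := hF.smooth.congr_of_eventuallyEq h.symm
  surjective := h.fderiv_eq (𝕜 := ℝ) ▸ hF.surjective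
  annihilated := h.fderiv_eq (𝕜 := ℝ) ▸ hF.annihilated

theorem IsInvariantSubmersionAt.castLE {W : Type*} [NormedAddCommGroup W] [NormedSpace ℝ W]
    {k l : ℕ} (hlk : l ≤ k) {L : Submodule ℝ (W →L[ℝ] W)} {F : W → Fin k → ℝ} {x : W}
    (hF : IsInvariantSubmersionAt L F x) :
    IsInvariantSubmersionAt L (fun y a => F y (Fin.castLE hlk a)) x := by
  let π : (Fin k → ℝ) →L[ℝ] (Fin l → ℝ) :=
    ContinuousLinearMap.pi fun a => ContinuousLinearMap.proj (Fin.castLE hlk a)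
  have hd : HasFDerivAt (fun y a => F y (Fin.castLE hlk a)) (π.comp (fderiv ℝ F x)) x :=
    π.hasFDerivAt.comp x (hF.smooth.differentiableAt (by simp)).hasFDerivAt
  refine ⟨π.contDiff.contDiffAt.comp x hF.smooth, ?_, fun A hA => ?_⟩
  · rw [hd.fderiv]
    intro c
    obtain ⟨v, hv⟩ := hF.surjective (Function.extend (Fin.castLE hlk) c 0)
    refine ⟨v, funext fun a => ?_⟩
    rw [ContinuousLinearMap.comp_apply, hv]
    exact (Fin.castLE_injective hlk).extend_apply _ _ _
  · rw [hd.fderiv, ContinuousLinearMap.comp_apply, hF.annihilated A hA, map_zero]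

theorem IsInvariantSubmersionAt.hasFDerivAt_apply {W : Type*} [NormedAddCommGroup W]
    [NormedSpace ℝ W] {k : ℕ} {L : Submodule ℝ (W →L[ℝ] W)} {F : W → Fin k → ℝ} {x : W}
    (hF : IsInvariantSubmersionAt L F x) (a : Fin k) :
    HasFDerivAt (fun y => F y a) ((ContinuousLinearMap.proj a).comp (fderiv ℝ F x)) x :=
  (ContinuousLinearMap.proj (R := ℝ) (φ := fun _ : Fin k => ℝ) a).hasFDerivAt.comp x
    (hF.smooth.differentiableAt (by simp)).hasFDerivAt

theorem exists_isMaxOn_nat {X : Type*} {V : Set X} (hV : V.Nonempty) (f : X → ℕ) {n : ℕ}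
    (hf : ∀ x ∈ V, f x ≤ n) : ∃ w ∈ V, ∀ x ∈ V, f x ≤ f w := by
  obtain ⟨w, hw, h⟩ := (measure fun x => n - f x).wf.has_min V hV
  refine ⟨w, hw, fun x hx => ?_⟩
  have h1 : ¬ (n - f x < n - f w) := h x hx
  have := hf x hx
  have := hf w hw
  omega

/-- A Lie algebra whose coadjoint forms are all degenerate has a non-trivial invariant. -/
theorem one_le_numInvariants (b : Module.Basis ι ℝ g)
    (hdeg : ∀ z : Module.Dual ℝ g, ∃ X : g, X ≠ 0 ∧ ∀ Y, z ⁅X, Y⁆ = 0) :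
    1 ≤ numInvariants b := by
  have : FiniteDimensional ℝ g := b.finiteDimensional_of_finite
  set L := dualAction b (LieAlgebra.ad ℝ g) with hL
  have hrank : ∀ x, Module.finrank ℝ (orbitTangent L x) < Fintype.card ι := by
    intro x
    obtain ⟨X, hX, hXY⟩ := hdeg (b.constr ℝ x)
    rw [hL, orbitTangent_dualAction, ← Module.finrank_eq_card_basis b]
    have hker : 0 < Module.finrank ℝ (LinearMap.ker (orbitMap b (LieAlgebra.ad ℝ g) x)) := by
      refine Module.finrank_pos_iff_exists_ne_zero.2 ⟨⟨X, ?_⟩, fun h => hX (congrArg Subtype.val h)⟩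
      exact funext fun j => (transposeOn_apply b _ x j).trans (hXY _)
    have := (orbitMap b (LieAlgebra.ad ℝ g) x).finrank_range_add_finrank_ker
    omega
  obtain ⟨U, hU, hUd, F, hF⟩ := exists_dense_of_local
    (fun x (F : (ι → ℝ) → Fin 1 → ℝ) => IsInvariantSubmersionAt L F x)
    (fun x F G h hF => hF.congr h) (fun V hV hVne => by
      obtain ⟨w, hw, hmax⟩ := exists_isMaxOn_nat hVne
        (fun x => Module.finrank ℝ (orbitTangent L x)) fun x _ => (hrank x).le
      have hlt := hrank w
      obtain ⟨F, hF⟩ := exists_isInvariantSubmersionAt (L := L) (commutator_mem_dualAction b _) rfl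
        ((hV.mem_nhds hw |> eventually_of_mem) hmax)
        (k := Fintype.card ι - Module.finrank ℝ (orbitTangent L w)) (by simp; omega)
      obtain ⟨O, hO, hOo, hwO⟩ := mem_nhds_iff.1 (hF.and (hV.mem_nhds hw))
      exact ⟨O, fun x hx => (hO hx).2, hOo, ⟨w, hwO⟩, _,
        fun x hx => (hO hx).1.castLE (by omega : 1 ≤ _)⟩)
  have hfam : IsIndependentFamilyOn b U fun a x => F x a := by
    refine ⟨fun a => ⟨fun x hx => ?_, fun i x hx => ?_⟩, fun x hx => subset_closure ⟨hx, ?_⟩⟩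
    · exact (contDiffAt_pi.1 (hF x hx).smooth a).contDiffWithinAt
    · rw [coadjointField_eq, ((hF x hx).hasFDerivAt_apply a).fderiv,
        ContinuousLinearMap.comp_apply, (hF x hx).annihilated _ (mem_dualAction.2 ⟨b i, rfl⟩), map_zero, neg_zero]
    · have h : (fun a => fderiv ℝ (fun y => F y a) x) =
          fun a => (ContinuousLinearMap.proj a).comp (fderiv ℝ F x) :=
        funext fun a => ((hF x hx).hasFDerivAt_apply a).fderiv
      rw [h]
      exact linearIndependent_of_surjective (hF x hx).surjective
  exact le_iSup₂_of_le 1 ⟨U, hU, hUd, _, hfam⟩ (by simp)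

end Coordinates

/-! ### Generic stabilizers and the invariants of the semidirect sum -/

section Rank

variable {ι : Type*} [Fintype ι] {s V : Type*} [LieRing s] [LieAlgebra ℝ s] [AddCommGroup V]
  [Module ℝ V]

theorem transposeOn_apply_eq_zero_iff (b : Module.Basis ι ℝ V) (T : Module.End ℝ V) (w : ι → ℝ) :
    transposeOn b T w = 0 ↔ ∀ v, b.constr ℝ w (T v) = 0 := by
  constructor
  · intro h v
    rw [← constr_transposeOn, h, map_zero, LinearMap.zero_apply]
  · intro h
    exact funext fun j => (transposeOn_apply b T w j).trans (h _)

/-- The stabilizer of `w` in `s`, under the representation dual to `ρ`, is zero. -/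
def IsFreeAt (b : Module.Basis ι ℝ V) (ρ : s →ₗ⁅ℝ⁆ Module.End ℝ V) (w : ι → ℝ) : Prop :=
  ∀ x, transposeOn b (ρ x) w = 0 → x = 0

theorem isFreeAt_iff_ker_orbitMap {b : Module.Basis ι ℝ V} {ρ : s →ₗ⁅ℝ⁆ Module.End ℝ V}
    {w : ι → ℝ} : IsFreeAt b ρ w ↔ LinearMap.ker (orbitMap b ρ w) = ⊥ := by
  rw [LinearMap.ker_eq_bot']; rfl

theorem finrank_orbitTangent_le [FiniteDimensional ℝ s] (b : Module.Basis ι ℝ V)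
    (ρ : s →ₗ⁅ℝ⁆ Module.End ℝ V) (w : ι → ℝ) :
    Module.finrank ℝ (orbitTangent (dualAction b ρ) w) ≤ Module.finrank ℝ s := by
  rw [orbitTangent_dualAction]
  exact LinearMap.finrank_range_le _

theorem isFreeAt_iff_finrank_orbitTangent [FiniteDimensional ℝ s] {b : Module.Basis ι ℝ V}
    {ρ : s →ₗ⁅ℝ⁆ Module.End ℝ V} {w : ι → ℝ} : IsFreeAt b ρ w ↔
      Module.finrank ℝ (orbitTangent (dualAction b ρ) w) = Module.finrank ℝ s := by
  rw [orbitTangent_dualAction]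
  have := (orbitMap b ρ w).finrank_range_add_finrank_ker
  rw [isFreeAt_iff_ker_orbitMap, ← Submodule.finrank_eq_zero (R := ℝ)]
  omega

theorem eventually_isFreeAt [FiniteDimensional ℝ s] {b : Module.Basis ι ℝ V}
    {ρ : s →ₗ⁅ℝ⁆ Module.End ℝ V} {w : ι → ℝ} (hw : IsFreeAt b ρ w) :
    ∀ᶠ x in 𝓝 w, IsFreeAt b ρ x := by
  let c := Module.finBasis ℝ s
  have hiff : ∀ x, IsFreeAt b ρ x ↔ LinearIndependent ℝ fun i => transposeOn b (ρ (c i)) x := by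
    intro x
    rw [isFreeAt_iff_ker_orbitMap]
    refine ⟨fun h => c.linearIndependent.map' (orbitMap b ρ x) h, fun h => ?_⟩
    rw [LinearMap.ker_eq_bot']
    intro y hy
    rw [← c.sum_repr y, map_sum] at hy
    simp only [map_smul] at hy
    have h0 := Fintype.linearIndependent_iff.1 h _ hy
    rw [← c.sum_repr y]
    simp [h0]
  have hcont : Continuous fun x : ι → ℝ => fun i => transposeOn b (ρ (c i)) x := by fun_prop
  simp only [hiff] at hw ⊢
  exact hcont.continuousAt.eventually (isOpen_setOfPred_linearIndependent.mem_nhds hw)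

/-- If all nonzero elements of `s` act by endomorphisms of rank at least `dim s`, then the
stabilizers of the dual representation are generically zero. -/
theorem exists_isFreeAt [FiniteDimensional ℝ s] (b : Module.Basis ι ℝ V)
    (ρ : s →ₗ⁅ℝ⁆ Module.End ℝ V)
    (hρ : ∀ x, x ≠ 0 → Module.finrank ℝ s ≤ Module.finrank ℝ (LinearMap.range (ρ x)))
    {U : Set (ι → ℝ)} (hU : IsOpen U) (hUne : U.Nonempty) : ∃ w ∈ U, IsFreeAt b ρ w := by
  obtain ⟨w, hw, hmax⟩ := exists_isMaxOn_nat hUne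
    (fun x => Module.finrank ℝ (orbitTangent (dualAction b ρ) x))
    fun x _ => finrank_orbitTangent_le b ρ x
  refine ⟨w, hw, ?_⟩
  by_contra hfree
  have hlt := lt_of_le_of_ne (finrank_orbitTangent_le b ρ w)
    (mt isFreeAt_iff_finrank_orbitTangent.2 hfree)
  obtain ⟨x, hxw, hx⟩ : ∃ x, transposeOn b (ρ x) w = 0 ∧ x ≠ 0 := by
    simpa [IsFreeAt] using hfree
  have hle : LinearMap.range (transposeOn b (ρ x) : (ι → ℝ) →ₗ[ℝ] (ι → ℝ)) ≤
      orbitTangent (dualAction b ρ) w := by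
    rintro _ ⟨y, rfl⟩
    exact apply_mem_orbitTangent_of_isLocalMax (eventually_of_mem (hU.mem_nhds hw) hmax)
      (mem_dualAction.2 ⟨x, rfl⟩) hxw y
  have h1 := Submodule.finrank_mono hle
  rw [finrank_range_transposeOn] at h1
  have := hρ x hx
  omega

end Rank

section SemidirectSum

variable {s r : Type*} [LieRing s] [LieAlgebra ℝ s] [LieRing r] [LieAlgebra ℝ r]
  (R : s →ₗ⁅ℝ⁆ LieDerivation ℝ r r) {ιr ιs : Type*}

theorem sumBasis_inl (br : Module.Basis ιr ℝ r) (bs : Module.Basis ιs ℝ s) (i : ιr) :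
    sumBasis R br bs (Sum.inl i) = LieAlgebra.SemiDirectSum.inl R (br i) := by
  simp only [sumBasis, Module.Basis.map_apply, Module.Basis.prod_apply, Sum.elim_inl]
  rfl

variable [Fintype ιr] [Fintype ιs]

/-- The restriction of a functional on the semidirect sum to `r`, in coordinates. -/
def restrictCoord (ιr ιs : Type*) [Fintype ιr] [Fintype ιs] : (ιr ⊕ ιs → ℝ) →L[ℝ] (ιr → ℝ) :=
  ContinuousLinearMap.pi fun i => ContinuousLinearMap.proj (Sum.inl i)

theorem restrictCoord_surjective : Function.Surjective (restrictCoord ιr ιs) :=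
  fun x => ⟨Sum.elim x 0, rfl⟩

theorem constr_restrictCoord (br : Module.Basis ιr ℝ r) (bs : Module.Basis ιs ℝ s)
    (z : ιr ⊕ ιs → ℝ) (y : r) :
    br.constr ℝ (restrictCoord ιr ιs z) y =
      (sumBasis R br bs).constr ℝ z (LieAlgebra.SemiDirectSum.inl R y) := by
  have h : br.constr ℝ (restrictCoord ιr ιs z) =
      ((sumBasis R br bs).constr ℝ z).comp
        (LieAlgebra.SemiDirectSum.inl R : r →ₗ[ℝ] LieAlgebra.SemiDirectSum r s R) := by
    refine br.ext fun i => ?_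
    rw [br.constr_basis, LinearMap.comp_apply]
    have := sumBasis_inl R br bs i
    change _ = (sumBasis R br bs).constr ℝ z (LieAlgebra.SemiDirectSum.inl R (br i))
    rw [← this, Module.Basis.constr_basis]
    rfl
  rw [h]; rfl

/-- As `r` is abelian, the coadjoint action induces on the dual of `r` the dual of the representation
`R`. -/
theorem restrictCoord_transposeOn_ad (hr : ∀ x y : r, ⁅x, y⁆ = 0)
    (br : Module.Basis ιr ℝ r) (bs : Module.Basis ιs ℝ s)
    (X : LieAlgebra.SemiDirectSum r s R) (z : ιr ⊕ ιs → ℝ) :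
    restrictCoord ιr ιs (transposeOn (sumBasis R br bs) (LieAlgebra.ad ℝ _ X) z) =
      transposeOn br (repHom R X.right) (restrictCoord ιr ιs z) := by
  funext j
  rw [transposeOn_apply, constr_restrictCoord R br bs]
  change transposeOn (sumBasis R br bs) (LieAlgebra.ad ℝ _ X) z (Sum.inl j) = _
  rw [transposeOn_apply, sumBasis_inl, LieAlgebra.ad_apply]
  congr 1
  simp [hr]

/-- Upper bound for the number of independent covectors at `z` that vanish on the coadjoint vector
fields, when the restriction of `z` to `r` has zero stabilizer in `s`. Such covectors are elements
`X` of the semidirect sum with `z ⁅Y, X⁆ = 0` for all `Y`; taking `Y` in `r` shows that the component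
of `X` in `s` stabilizes the restriction of `z`, and taking `Y` in `s` puts `X` in the annihilator of
the tangent space of an orbit. -/
theorem card_le_of_linearIndependent_of_annihilated [DecidableEq ιr] [DecidableEq ιs]
    [FiniteDimensional ℝ s] [FiniteDimensional ℝ r]
    (hr : ∀ x y : r, ⁅x, y⁆ = 0) (br : Module.Basis ιr ℝ r) (bs : Module.Basis ιs ℝ s)
    {z : ιr ⊕ ιs → ℝ} (hz : IsFreeAt br (repHom R) (restrictCoord ιr ιs z)) {l : ℕ}
    {D : Fin l → (ιr ⊕ ιs → ℝ) →L[ℝ] ℝ} (hD : LinearIndependent ℝ D)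
    (hann : ∀ a i, D a (transposeOn (sumBasis R br bs)
      (LieAlgebra.ad ℝ _ (sumBasis R br bs i)) z) = 0) :
    l + Module.finrank ℝ s ≤ Module.finrank ℝ r := by
  set b := sumBasis R br bs with hb
  set ξ : Module.Dual ℝ r := br.constr ℝ (restrictCoord ιr ιs z) with hξ
  -- the element of the Lie algebra that represents a covector on its dual space
  let Ψ : ((ιr ⊕ ιs → ℝ) →L[ℝ] ℝ) →ₗ[ℝ] LieAlgebra.SemiDirectSum r s R :=
    { toFun := fun f => ∑ j, f (Pi.single j 1) • b j
      map_add' := fun f f' => by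
        simp only [add_apply, add_smul, Finset.sum_add_distrib]
      map_smul' := fun c f => by
        simp only [smul_apply, smul_assoc, Finset.smul_sum, RingHom.id_apply] }
  have hΨ : ∀ f x, f x = b.constr ℝ x (Ψ f) := by
    intro f x
    have h1 : b.constr ℝ x (Ψ f) = ∑ j, f (Pi.single j 1) • x j := by
      change b.constr ℝ x (∑ j, f (Pi.single j 1) • b j) = _
      simp only [map_sum, map_smul, b.constr_basis]
    rw [h1]
    conv_lhs => rw [pi_eq_sum_univ' x]
    simp only [map_sum, map_smul, smul_eq_mul, mul_comm]
  have hΨinj : LinearMap.ker Ψ = ⊥ := by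
    rw [LinearMap.ker_eq_bot']
    intro f hf
    ext x
    rw [hΨ, hf, map_zero, zero_apply]
  have hXY : ∀ a (Y : LieAlgebra.SemiDirectSum r s R), b.constr ℝ z ⁅Y, Ψ (D a)⁆ = 0 := by
    intro a Y
    rw [← b.sum_repr Y, sum_lie, map_sum]
    refine Finset.sum_eq_zero fun i _ => ?_
    rw [smul_lie, map_smul]
    have := hann a i
    rw [hΨ, constr_transposeOn, LieAlgebra.ad_apply] at this
    rw [this, smul_zero]
  have hinl : ∀ y : r, b.constr ℝ z ⟨y, 0⟩ = ξ y := fun y =>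
    (constr_restrictCoord R br bs z y).symm
  have hright : ∀ a, (Ψ (D a)).right = 0 := by
    intro a
    refine hz _ ((transposeOn_apply_eq_zero_iff br _ _).2 fun y => ?_)
    have h1 := hXY a ⟨y, 0⟩
    have h2 : ⁅(⟨y, 0⟩ : LieAlgebra.SemiDirectSum r s R), Ψ (D a)⁆ =
        -⟨R (Ψ (D a)).right y, 0⟩ := by simp [hr]
    rw [h2, map_neg, neg_eq_zero, hinl] at h1
    exact h1
  -- the annihilator in `r` of the tangent space of the orbit of `ξ`
  let B : s →ₗ[ℝ] Module.Dual ℝ r :=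
    (LinearMap.compRight ℝ ξ).comp (repHom R : s →ₗ[ℝ] Module.End ℝ r)
  have hB : Function.Injective B := by
    rw [← LinearMap.ker_eq_bot, LinearMap.ker_eq_bot']
    intro x hx
    exact hz x ((transposeOn_apply_eq_zero_iff br _ _).2 fun y => congrArg (fun φ => φ y) hx)
  have hsurj : Function.Surjective B.flip := by
    have h1 : B.flip = B.dualMap.comp (Module.Dual.eval ℝ r) := rfl
    rw [h1, LinearMap.coe_comp]
    exact (LinearMap.dualMap_surjective_of_injective hB).comp (Module.evalEquiv ℝ r).surjective
  have hK := B.flip.finrank_range_add_finrank_ker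
  rw [LinearMap.range_eq_top.2 hsurj, finrank_top, Subspace.dual_finrank_eq] at hK
  have hmem : ∀ a, (Ψ (D a)).left ∈ LinearMap.ker B.flip := by
    intro a
    refine LinearMap.ext fun x => ?_
    have h1 := hXY a ⟨0, x⟩
    have h2 : ⁅(⟨0, x⟩ : LieAlgebra.SemiDirectSum r s R), Ψ (D a)⁆ = ⟨R x (Ψ (D a)).left, 0⟩ := by
      simp [hright a]
    rw [h2, hinl] at h1
    exact h1
  have hindep : LinearIndependent ℝ fun a => (Ψ (D a)).left := by
    have h1 := hD.map' Ψ hΨinj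
    rw [Fintype.linearIndependent_iff] at h1 ⊢
    intro c hc
    refine h1 c ?_
    have h2 : ∀ a, (Ψ ∘ D) a = LieAlgebra.SemiDirectSum.inl R (Ψ (D a)).left := fun a =>
      LieAlgebra.SemiDirectSum.ext rfl (hright a)
    simp only [h2, ← map_smul, ← map_sum, hc, map_zero]
  have hindep' : LinearIndependent ℝ fun a => (⟨_, hmem a⟩ : LinearMap.ker B.flip) :=
    LinearIndependent.of_comp (LinearMap.ker B.flip).subtype hindep
  have := hindep'.fintype_card_le_finrank
  rw [Fintype.card_fin] at this
  omega

/-- The invariants of the action of `s` on the dual of `r` form a fundamental set of invariants of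
the semidirect sum when the stabilizers are generically zero. -/
theorem exists_isFundamentalSet [DecidableEq ιr] [DecidableEq ιs] [FiniteDimensional ℝ s]
    [FiniteDimensional ℝ r] (hr : ∀ x y : r, ⁅x, y⁆ = 0)
    (hR : ∀ x, x ≠ 0 → Module.finrank ℝ s ≤ Module.finrank ℝ (LinearMap.range (repHom R x)))
    (br : Module.Basis ιr ℝ r) (bs : Module.Basis ιs ℝ s) {k : ℕ}
    (hk : k + Module.finrank ℝ s = Module.finrank ℝ r) :
    ∃ (U : Set (ιr ⊕ ιs → ℝ)) (F : Fin k → (ιr ⊕ ιs → ℝ) → ℝ),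
      IsFundamentalSet (sumBasis R br bs) U F ∧
      ∀ a, DependsOnlyOn (Set.range Sum.inl) U (F a) := by
  set L := dualAction br (repHom R) with hL
  have hcard : Module.finrank ℝ (ιr → ℝ) = Module.finrank ℝ r := by
    rw [Module.finrank_fintype_fun_eq_card, Module.finrank_eq_card_basis br]
  obtain ⟨U, hU, hUd, f, hf⟩ := exists_dense_of_local
    (fun x (F : (ιr → ℝ) → Fin k → ℝ) => IsInvariantSubmersionAt L F x)
    (fun x F G h hF => hF.congr h) (fun V hV hVne => by
      obtain ⟨w, hw, hfree⟩ := exists_isFreeAt br (repHom R) hR hV hVne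
      obtain ⟨F, hF⟩ := exists_isInvariantSubmersionAt (L := L) (commutator_mem_dualAction br _)
        (isFreeAt_iff_finrank_orbitTangent.1 hfree)
        (Eventually.of_forall fun x => finrank_orbitTangent_le br _ x) (hk.trans hcard.symm)
      obtain ⟨O, hO, hOo, hwO⟩ := mem_nhds_iff.1 (hF.and (hV.mem_nhds hw))
      exact ⟨O, fun x hx => (hO hx).2, hOo, ⟨w, hwO⟩, F, fun x hx => (hO hx).1⟩)
  let p := restrictCoord ιr ιs
  have hpopen : IsOpenMap p := p.isOpenMap restrictCoord_surjective
  have hder : ∀ z, p z ∈ U → ∀ a, HasFDerivAt (fun z => f (p z) a)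
      ((ContinuousLinearMap.proj a).comp ((fderiv ℝ f (p z)).comp p)) z := by
    intro z hz a
    exact ((hf _ hz).hasFDerivAt_apply a).comp z p.hasFDerivAt
  refine ⟨p ⁻¹' U, fun a z => f (p z) a, ⟨hU.preimage p.continuous, hUd.preimage hpopen,
    ⟨fun a => ⟨fun z hz => ?_, fun i z hz => ?_⟩, fun z hz => subset_closure ⟨hz, ?_⟩⟩, ?_⟩, ?_⟩
  · exact ((contDiffAt_pi.1 (hf _ hz).smooth a).comp z p.contDiff.contDiffAt).contDiffWithinAt
  · rw [coadjointField_eq, (hder z hz a).fderiv, ContinuousLinearMap.comp_apply,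
      ContinuousLinearMap.comp_apply, restrictCoord_transposeOn_ad R hr,
      (hf _ hz).annihilated _ (mem_dualAction.2 ⟨_, rfl⟩), map_zero, neg_zero]
  · have h : (fun a => fderiv ℝ (fun z => f (p z) a) z) =
        fun a => (ContinuousLinearMap.proj a).comp ((fderiv ℝ f (p z)).comp p) :=
      funext fun a => (hder z hz a).fderiv
    rw [h]
    exact linearIndependent_of_surjective ((hf _ hz).surjective.comp restrictCoord_surjective)
  · intro V hV hVne l G hG
    obtain ⟨_, ⟨z₀, hz₀, rfl⟩, hfree⟩ := exists_isFreeAt br (repHom R) hR (hpopen V hV) (hVne.image p)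
    have hev := p.continuous.continuousAt.eventually (eventually_isFreeAt hfree)
    obtain ⟨z, hzfree, hzV, hzind⟩ := mem_closure_iff_nhds.1 (hG.independent hz₀) _ hev
    have := card_le_of_linearIndependent_of_annihilated R hr br bs hzfree hzind fun a i => by
      have := (hG.invariant a).annihilated i z hzV
      rwa [coadjointField_eq, neg_eq_zero] at this
    omega
  · intro a x _ y _ hxy
    have : p x = p y := funext fun i => hxy _ ⟨i, rfl⟩
    simp only [this]

end SemidirectSum

end LieInvariants

theorem theorem2
    {s r : Type*} [LieRing s] [LieAlgebra ℝ s] [LieRing r] [LieAlgebra ℝ r]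
    -- `s` is `sl(2, ℝ)` or `so(3)`
    (hs : Nonempty (s ≃ₗ⁅ℝ⁆ LieAlgebra.SpecialLinear.sl (Fin 2) ℝ) ∨
      Nonempty (s ≃ₗ⁅ℝ⁆ LieAlgebra.Orthogonal.so (Fin 3) ℝ))
    -- `r` is a finite-dimensional solvable Lie algebra
    [FiniteDimensional ℝ r] [LieAlgebra.IsSolvable r]
    -- `R` is an irreducible representation of `s` on `r`
    (R : s →ₗ⁅ℝ⁆ LieDerivation ℝ r r) (hR : LieInvariants.IsIrreducibleRep R) :
    -- the semidirect sum has non-trivial invariants (whatever basis is used)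
    (∀ {ι : Type} [Fintype ι] [DecidableEq ι]
        (b : Module.Basis ι ℝ (LieAlgebra.SemiDirectSum r s R)),
      0 < LieInvariants.numInvariants b) ∧
    -- if `dim r > dim s`, some fundamental set depends only on the variables of `r`
    (Module.finrank ℝ s < Module.finrank ℝ r →
      ∀ {ιr ιs : Type} [Fintype ιr] [DecidableEq ιr] [Fintype ιs] [DecidableEq ιs]
        (br : Module.Basis ιr ℝ r) (bs : Module.Basis ιs ℝ s),
      ∃ (k : ℕ) (U : Set (ιr ⊕ ιs → ℝ)) (F : Fin k → (ιr ⊕ ιs → ℝ) → ℝ),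
        LieInvariants.IsFundamentalSet (LieInvariants.sumBasis R br bs) U F ∧
        (∀ a, LieInvariants.DependsOnlyOn (Set.range Sum.inl) U (F a)) ∧
        -- for `sl(2, ℝ)` and `dim r` odd it has `2m - 6` elements, `2m` being the total dimension
        (Nonempty (s ≃ₗ⁅ℝ⁆ LieAlgebra.SpecialLinear.sl (Fin 2) ℝ) → Odd (Module.finrank ℝ r) →
          ∀ m : ℕ, Module.finrank ℝ (LieAlgebra.SemiDirectSum r s R) = 2 * m →
            k + 6 = 2 * m)) := by
  have h3 := LieInvariants.finrank_eq_three hs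
  have : FiniteDimensional ℝ s := FiniteDimensional.of_finrank_pos (by omega)
  have hab := hR.lie_eq_zero
  have hnt : Nontrivial r := hR.1
  refine ⟨fun b => ?_, fun hlt ιr ιs _ _ _ _ br bs => ?_⟩
  · exact lt_of_lt_of_le zero_lt_one (LieInvariants.one_le_numInvariants b
      (LieInvariants.exists_lie_eq_zero (LieInvariants.eq_zero_of_map_lie_eq_zero hs) h3 hab R))
  · have hrank : ∀ x, x ≠ 0 → Module.finrank ℝ s ≤
        Module.finrank ℝ (LinearMap.range (LieInvariants.repHom R x)) := by
      intro x hx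
      rw [h3]
      exact LieInvariants.lt_finrank_range hs (LieInvariants.repHom R) hR.2 (by omega) hx
    obtain ⟨U, F, hF, hdep⟩ := LieInvariants.exists_isFundamentalSet R hab hrank br bs
      (k := Module.finrank ℝ r - 3) (by omega)
    refine ⟨_, U, F, hF, hdep, fun _ _ m hm => ?_⟩
    rw [(LieAlgebra.SemiDirectSum.toProdl R).finrank_eq, Module.finrank_prod] at hm
    omega
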